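/- Let $\theta\in\mathbb R$ and let $\mathscr A=C^\infty(\mathbb T^2_\theta)$ be the smooth noncommutative two-torus, i.e. the algebra of all series $\sum_{(n,m)\in\mathbb Z^2}a_{n,m}U^nV^m$ with rapidly decaying coefficients, where $U,V$ are the standard unitary generators on $\ell^2(\mathbb Z^2)$, with $UV=e^{i\theta}VU$. Let $\varphi_0(\sum a_{n,m}U^nV^m)=a_{0,0}$ be the canonical trace, and let $\nabla$ be one of the two basic derivations $\nabla_1(U^nV^m)=in\,U^nV^m$, $\nabla_2(U^nV^m)=im\,U^nV^m$. Let $h=h^*\in\mathscr A$. For $n\ge 0$ let $\mathcal C_{\mathrm{Spec}}(n,h)$ be the set of functions $f(x_0,\dots,x_n)$ that are smooth on $W^{n+1}$ for some open neighbourhood $W\subset\mathbb R$ of the spectrum of $h$. For such $f$ put $$\mathscr S_h(f)(\rho_1\otimes\cdots\otimes\rho_n)=\int_{\mathbb R^{n+1}}\hat g(\xi)\,e^{i\xi_0h}\rho_1e^{i\xi_1h}\cdots\rho_ne^{i\xi_nh}\,d\xi ,$$ where $g\in C_c^\infty(\mathbb R^{n+1})$ agrees with $f$ on $W'^{\,n+1}$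 for some open neighbourhood $W'$ of the spectrum of $h$ (the choice of $g$ does not matter), and $\hat g$ is normalized by $g(x)=\int\hat g(\xi)e^{ix\cdot\xi}d\xi$. For a function $f$ of $n+1$ variables let $(\tau f)(x_0,\dots,x_n)=f(x_n,x_0,\dots,x_{n-1})$ and, for $0\le j\le n$, $$(\delta_jf)(x_0,\dots,x_{n+1})=\frac{f(x_0,\dots,x_{j-1},x_j,x_{j+2},\dots,x_{n+1})-f(x_0,\dots,x_{j-1},x_{j+1},x_{j+2},\dots,x_{n+1})}{x_j-x_{j+1}},$$ understood as $(\partial_{x_j}f)(x_0,\dots,x_j,x_{j+2},\dots,x_{n+1})$ when $x_j=x_{j+1}$; for $n=1$ let moreover $\delta_2=\tau\delta_0$. Let $T\in\mathcal C_{\mathrm{Spec}}(1,h)$ and $F(k)=\varphi_0\big(\mathscr S_k(T)(\nabla k)\cdot\nabla k\big)$, for self-adjoint $k\in\mathscr A$ near $h$. Put $$K=-(1+\tau)(T),\qquad H=(\delta_0+\delta_1-\delta_2)(K).$$ Then $K\in\mathcal C_{\mathrm{Spec}}(1,h)$, $H\in\mathcal C_{\mathrm{Spec}}(2,h)$, and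 the gradient of $F$ at $h$, that is, the unique element $\operatorname{grad}_hF\in\mathscr A$ with $\frac{d}{d\varepsilon}\big|_{\varepsilon=0}F(h+\varepsilon a)=\varphi_0(\operatorname{grad}_hF\cdot a)$ for all $a=a^*\in\mathscr A$, exists and equals $$\operatorname{grad}_hF=\mathscr S_h(K)(\nabla^2h)+\mathscr S_h(H)(\nabla h\otimes\nabla h).$$ Moreover, this recovers the Connes–Moscovici functional relation: if $S\subset\mathbb R$ and $\tilde K$ is a function with $K(x_0,x_1)=\tilde K(x_1-x_0)$ for $x_0,x_1\in S$, then, for all $x_0,x_1,x_2\in S$ such that $u=x_1-x_0$, $v=x_2-x_1$ and $u+v$ are non-zero, $$-H(x_0,x_1,x_2)=\frac{\tilde K(v)-\tilde K(u)}{u+v}+\frac{\tilde K(u+v)-\tilde K(v)}{u}-\frac{\tilde K(u+v)-\tilde K(u)}{v}.$$ -/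

import Mathlib

open scoped SchwartzMap ContDiff InnerProductSpace
open Complex (I)

namespace NCTorus

/-! ### The smooth noncommutative two-torus, in its standard representation on `ℓ²(ℤ²)` -/

/-- The Hilbert space `ℓ²(ℤ²)`; the basis vector `e_{(n,m)}` corresponds to `U^n V^m`. -/
abbrev Hilb : Type := lp (fun _ : ℤ × ℤ => ℂ) 2

/-- The `C^*`-algebra of bounded operators on `ℓ²(ℤ²)`. -/
abbrev Op : Type := Hilb →L[ℂ] Hilb

theorem hasSum_shift (p : ℤ × ℤ) (c : ℤ × ℤ → Circle) (ψ : Hilb) :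
    HasSum (fun k : ℤ × ℤ => ‖(c (k - p) : ℂ) * ψ (k - p)‖ ^ (2 : ENNReal).toReal)
      (‖ψ‖ ^ (2 : ENNReal).toReal) := by
  have h := lp.hasSum_norm (p := 2) (by norm_num) ψ
  have h' := ((Equiv.subRight p).hasSum_iff).2 h
  simp only [norm_mul, Circle.norm_coe, one_mul]
  exact h'

/-- The isometry of `ℓ²(ℤ²)` with `e_k ↦ c k • e_{k+p}`. -/
noncomputable def shift (p : ℤ × ℤ) (c : ℤ × ℤ → Circle) : Hilb →ₗᵢ[ℂ] Hilb where
  toFun ψ := ⟨fun k => (c (k - p) : ℂ) * ψ (k - p), memℓp_gen (hasSum_shift p c ψ).summable⟩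
  map_add' ψ χ := by
    ext k
    exact mul_add _ _ _
  map_smul' z ψ := by
    ext k
    exact mul_left_comm _ _ _
  norm_map' ψ := by
    have h := lp.norm_rpow_eq_tsum (p := 2) (by norm_num)
      (⟨fun k => (c (k - p) : ℂ) * ψ (k - p), memℓp_gen (hasSum_shift p c ψ).summable⟩ : Hilb)
    rw [(hasSum_shift p c ψ).tsum_eq] at h
    exact (Real.rpow_left_inj (norm_nonneg _) (norm_nonneg _) (by norm_num)).1 h

theorem shift_apply (p : ℤ × ℤ) (c : ℤ × ℤ → Circle) (ψ : Hilb) (k : ℤ × ℤ) :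
    shift p c ψ k = (c (k - p) : ℂ) * ψ (k - p) := rfl

/-- The same isometry as a unitary operator. -/
noncomputable def phaseShift (p : ℤ × ℤ) (c : ℤ × ℤ → Circle) : Hilb ≃ₗᵢ[ℂ] Hilb :=
  LinearIsometryEquiv.ofSurjective (shift p c) fun ψ => by
    refine ⟨shift (-p) (fun k => (c (k - p))⁻¹) ψ, ?_⟩
    ext k
    simp [shift_apply]

/-- The generator `U`: `e_{(n,m)} ↦ e_{(n+1,m)}`. -/
noncomputable def genU : Hilb ≃ₗᵢ[ℂ] Hilb := phaseShift (1, 0) fun _ => 1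

/-- The generator `V`: `e_{(n,m)} ↦ e^{-iθn} e_{(n,m+1)}`, so that `U V = e^{iθ} V U`. -/
noncomputable def genV (θ : ℝ) : Hilb ≃ₗᵢ[ℂ] Hilb :=
  phaseShift (0, 1) fun k => Circle.exp (-(θ * k.1))

/-- The monomial `U^n V^m`, `p = (n, m)`. -/
noncomputable def monomial (θ : ℝ) (p : ℤ × ℤ) : Op :=
  ((genU ^ p.1 * genV θ ^ p.2 : Hilb ≃ₗᵢ[ℂ] Hilb) : Hilb →L[ℂ] Hilb)

/-- Rapidly decaying families of coefficients on `ℤ²`. -/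
def RapidDecay (a : ℤ × ℤ → ℂ) : Prop :=
  ∀ k : ℕ, ∃ C : ℝ, ∀ p : ℤ × ℤ, (1 + |(p.1 : ℝ)| + |(p.2 : ℝ)|) ^ k * ‖a p‖ ≤ C

/-- The algebra `C^∞(𝕋²_θ)`: the sums `∑ a_{(n,m)} U^n V^m` with rapidly decaying coefficients. -/
def smoothTorus (θ : ℝ) : Set Op :=
  {x | ∃ a : ℤ × ℤ → ℂ, RapidDecay a ∧ HasSum (fun p => a p • monomial θ p) x}

/-- The coefficient `a_p` of `x = ∑ a_{(n,m)} U^n V^m`: since `U^n V^m e_{(0,0)} = e_{(n,m)}`,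
it is the coordinate of `x e_{(0,0)}` at `p`. -/
noncomputable def coeff (x : Op) (p : ℤ × ℤ) : ℂ :=
  x (lp.single 2 (0 : ℤ × ℤ) (1 : ℂ)) p

/-- The canonical trace `φ₀ (∑ a_{(n,m)} U^n V^m) = a_{(0,0)}`. -/
noncomputable def trace (x : Op) : ℂ := coeff x 0

/-- The basic derivations: `∇ U^n V^m = i n U^n V^m` for `j = 0` and `i m U^n V^m` for `j = 1`,
the infinitesimal generators of `U^n V^m ↦ e^{i t n} U^n V^m` and `U^n V^m ↦ e^{i t m} U^n V^m`. -/
noncomputable def basicDeriv (θ : ℝ) (j : Fin 2) (x : Op) : Op :=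
  ∑' p : ℤ × ℤ, (I * ((![p.1, p.2] j : ℤ) : ℂ) * coeff x p) • monomial θ p

/-! ### Rearrangement operators -/

/-- `e^{iξ₀h} ρ₁ e^{iξ₁h} ρ₂ ⋯ ρₙ e^{iξₙh}`. -/
noncomputable def expWord (h : Op) {n : ℕ} (ξ : Fin (n + 1) → ℝ) (ρ : Fin n → Op) : Op :=
  NormedSpace.exp ((I * ξ 0) • h) *
    (List.ofFn fun j : Fin n => ρ j * NormedSpace.exp ((I * ξ j.succ) • h)).prod

/-- The Fourier transform, normalized such that `g x = ∫ ĝ(ξ) e^{i x·ξ} dξ`. -/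
noncomputable def fourierHat {n : ℕ} (g : 𝓢(EuclideanSpace ℝ (Fin n), ℂ))
    (ξ : EuclideanSpace ℝ (Fin n)) : ℂ :=
  ((2 * Real.pi) ^ n)⁻¹ * ∫ x, Complex.exp (-(I * ⟪x, ξ⟫_ℝ)) * g x

/-- Smooth spectral functions of `n + 1` variables: functions that are smooth on `U^{n+1}`
for some open neighbourhood `U ⊆ ℝ` of the spectrum of `h`. -/
def CSpec (n : ℕ) (h : Op) : Set ((Fin (n + 1) → ℝ) → ℂ) :=
  {f | ∃ U : Set ℝ, IsOpen U ∧ spectrum ℝ h ⊆ U ∧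
    ContDiffOn ℝ ∞ f (Set.univ.pi fun _ => U)}

/-- `g` is smooth with compact support, and equals `f` on `U^{n+1}` for some open neighbourhood
`U` of the spectrum of `h`. -/
def IsTestExtension {n : ℕ} (h : Op) (f : (Fin (n + 1) → ℝ) → ℂ)
    (g : 𝓢(EuclideanSpace ℝ (Fin (n + 1)), ℂ)) : Prop :=
  HasCompactSupport g ∧ ∃ U : Set ℝ, IsOpen U ∧ spectrum ℝ h ⊆ U ∧
    ∀ x : Fin (n + 1) → ℝ, (∀ j, x j ∈ U) → g (WithLp.toLp 2 x) = f x

open Classical in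
/-- The Schwartz functional calculus `𝓢_h(f) = f(h^{(0)}, …, h^{(n)})`, evaluated at the elementary
tensor `ρ₁ ⊗ ⋯ ⊗ ρₙ`:
`𝓢_h(f)(ρ₁ ⊗ ⋯ ⊗ ρₙ) = ∫ f̂(ξ) e^{iξ₀h} ρ₁ e^{iξ₁h} ⋯ ρₙ e^{iξₙh} dξ` for `f` smooth with compact
support. For self-adjoint `h` the integral depends on `f` near the `(n+1)`-st power of the spectrum
of `h` only, so a spectral function `f` is replaced by any test function that agrees with it
there. -/
noncomputable def rearr {n : ℕ} (h : Op) (f : (Fin (n + 1) → ℝ) → ℂ) (ρ : Fin n → Op) : Op :=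
  if H : ∃ g, IsTestExtension h f g then
    ∫ ξ : EuclideanSpace ℝ (Fin (n + 1)), fourierHat H.choose ξ • expWord h (fun j => ξ j) ρ
  else 0

/-! ### Face maps and cyclic operators -/

/-- The face map `δ^{(j,n)}`: `f(x₀, …, x_{j-1}, [x_j, x_{j+1}], x_{j+2}, …, x_{n+1})`, the divided
difference in the `j`-th argument, with its confluent value (the derivative) at
`x_j = x_{j+1}`. -/
noncomputable def face {n : ℕ} (j : Fin (n + 1)) (f : (Fin (n + 1) → ℝ) → ℂ) :
    (Fin (n + 2) → ℝ) → ℂ := fun x =>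
  dslope (fun z : ℝ => f (Function.update (fun l => x (j.succ.succAbove l)) j z))
    (x j.castSucc) (x j.succ)

/-- The cyclic operator `τ_{(n)}`: `f(xₙ, x₀, …, x_{n-1})`. -/
def cyc {n : ℕ} (f : (Fin (n + 1) → ℝ) → ℂ) : (Fin (n + 1) → ℝ) → ℂ := fun x =>
  f fun i => x (i - 1)

/-- The last face map `δ^{(n+1,n)} = τ_{(n+1)} δ^{(0,n)}`. -/
noncomputable def lastFace {n : ℕ} (f : (Fin (n + 1) → ℝ) → ℂ) : (Fin (n + 2) → ℝ) → ℂ :=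
  cyc (face 0 f)

/-! ### Functionals and gradients -/

/-- The functional `F(h) = φ₀(𝓢_h(T)(∇h) · ∇h)`. -/
noncomputable def quadFunctional (θ : ℝ) (j : Fin 2) (T : (Fin 2 → ℝ) → ℂ) (h : Op) : ℂ :=
  trace (rearr h T ![basicDeriv θ j h] * basicDeriv θ j h)

/-- `G ∈ C^∞(𝕋²_θ)` is a gradient of `F` at `h` with respect to `φ₀`:
`d/dε|_{ε=0} F(h + εa) = φ₀(G a)` for all self-adjoint `a ∈ C^∞(𝕋²_θ)`. -/
def IsGradient (θ : ℝ) (F : Op → ℂ) (h G : Op) : Prop :=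
  G ∈ smoothTorus θ ∧ ∀ a ∈ smoothTorus θ, IsSelfAdjoint a →
    HasDerivAt (fun ε : ℝ => F (h + ε • a)) (trace (G * a)) 0

end NCTorus

namespace NCTorus

/-! ### Duhamel's formula -/

section Duhamel

variable {A : Type*} [NormedRing A] [NormedAlgebra ℝ A] [CompleteSpace A]

/-! Choose a Fourier density `b` of `T`, so that `F(k) = ∫ b(w) φ₀(e^{iw₀k} ∇k e^{iw₁k} ∇k) dw`. The
spectrum is upper hemicontinuous, so the same `b` serves for all self-adjoint `k = h + εa` with
small `ε` (`IsDensity.eventually_add_smul`), and `F` can be differentiated under the integral. The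
product rule gives four terms: two in which an exponential is varied, by Duhamel's formula, and two
in which `∇h` is replaced by `∇a`. The trace property identifies the terms in pairs after the
exchange of `w₀` and `w₁`. Hence only one term of each kind survives, with the density `b(w₀,w₁) +
b(w₁,w₀)`, which is minus a density of `K` (`integral_trace_wordDeriv`).

In the surviving term with `∇a`, integration by parts frees `a`. The derivation falls on `∇h`, which
gives `𝓢_h(K)(∇²h)`, or on one of the two exponentials. In the other term, cyclicity of the trace
moves `a` to the end, and the two halves of the Duhamel integral then enclose the rest of the word.
These three Duhamel integrals are the three faces: a divided difference of `e^{ixξ}` is the integral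
over `s ∈ [0,1]` of `iξ` times exponentials with frequencies `(1-s)ξ` and `sξ`, which is exactly how
Duhamel's formula splits `e^{iξh}` (`IsFourierRep.face`, `IsDensity.rearr_face_zero`,
`IsDensity.rearr_face_one`, `IsDensity.rearr_lastFace_eq`).

Two analytic points support this. First, `rearr` uses an arbitrary test extension, while faces are
represented by integrals over larger parameter spaces; `rearr_eq` allows any representation, since
smearing with a cutoff that is 1 on the spectrum leaves each word unchanged. Second, `∇` is
unbounded. It is treated as a closed relation `IsDer` between operators commuting with the right
shifts, on which coefficients are faithful. Products, exponentials and integrals respect this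
relation, and bounded iterated derivatives in both directions force rapid decay, so the gradient
lies in the smooth algebra. It is unique because the trace separates points. The functional relation
is then algebra with divided differences and the symmetry of `K`. -/

theorem continuous_exp_comp {X : Type*} [TopologicalSpace X] {f : X → A} (hf : Continuous f) :
    Continuous fun x => NormedSpace.exp (f x) := by
  let +nondep : NormedAlgebra ℚ A := .restrictScalars ℚ ℝ A
  exact (NormedSpace.exp_continuous (𝔸 := A)).comp hf

/-- Duhamel's formula for a difference of exponentials. -/
theorem exp_sub_exp (X Y : A) :
    NormedSpace.exp X - NormedSpace.exp Y =
      ∫ s in (0 : ℝ)..1, NormedSpace.exp ((1 - s) • X) * (X - Y) * NormedSpace.exp (s • Y) := by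
  have hd : ∀ s : ℝ, HasDerivAt
      (fun s : ℝ => -(NormedSpace.exp ((1 - s) • X) * NormedSpace.exp (s • Y)))
      (NormedSpace.exp ((1 - s) • X) * (X - Y) * NormedSpace.exp (s • Y)) s := by
    intro s
    have h1 : HasDerivAt (fun s : ℝ => NormedSpace.exp ((1 - s) • X))
        (-(NormedSpace.exp ((1 - s) • X) * X)) s := by
      have := (hasDerivAt_exp_smul_const X (1 - s)).scomp s ((hasDerivAt_id s).const_sub 1)
      exact this.congr_deriv (by simp)
    have h2 := hasDerivAt_exp_smul_const' Y s
    refine ((h1.mul h2).neg).congr_deriv ?_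
    noncomm_ring
  rw [intervalIntegral.integral_eq_sub_of_hasDerivAt (fun s _ => hd s)]
  · simp [sub_eq_add_neg, add_comm]
  · refine Continuous.intervalIntegrable ?_ _ _
    exact ((continuous_exp_comp (by fun_prop)).mul continuous_const).mul
      (continuous_exp_comp (by fun_prop))

/-- The derivative of the exponential at `X` in the direction `Y`. -/
noncomputable def dexp (X Y : A) : A :=
  ∫ s in (0 : ℝ)..1, NormedSpace.exp ((1 - s) • X) * Y * NormedSpace.exp (s • X)

/-- At `ε = 0` the difference quotient is a Duhamel integral whose integrand is jointly continuous
in `ε` and `s`, so the limit may be taken inside. Other base points follow by translation in `ε`. -/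
theorem hasDerivAt_exp_add_smul (X Y : A) (t : ℝ) :
    HasDerivAt (fun ε : ℝ => NormedSpace.exp (X + ε • Y)) (dexp (X + t • Y) Y) t := by
  have key : ∀ Z : A, HasDerivAt (fun ε : ℝ => NormedSpace.exp (Z + ε • Y)) (dexp Z Y) 0 := by
    intro Z
    rw [hasDerivAt_iff_tendsto_slope]
    have hc : Continuous fun ε : ℝ => ∫ s in (0 : ℝ)..1,
        NormedSpace.exp ((1 - s) • (Z + ε • Y)) * Y * NormedSpace.exp (s • Z) := by
      apply intervalIntegral.continuous_parametric_intervalIntegral_of_continuous'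
      exact ((continuous_exp_comp (by fun_prop)).mul continuous_const).mul
        (continuous_exp_comp (by fun_prop))
    have ht := hc.tendsto 0
    simp only [zero_smul, add_zero] at ht
    refine (ht.mono_left nhdsWithin_le_nhds).congr' ?_
    filter_upwards [self_mem_nhdsWithin] with ε hε
    have hε : ε ≠ 0 := hε
    rw [slope_def_module, zero_smul, add_zero, sub_zero, exp_sub_exp]
    simp only [add_sub_cancel_left, mul_smul_comm, smul_mul_assoc]
    rw [intervalIntegral.integral_smul, smul_smul, inv_mul_cancel₀ hε, one_smul]
  have h := (key (X + t • Y)).scomp_of_eq (x := t) (h := fun ε : ℝ => ε - t)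
    ((hasDerivAt_id t).sub_const t) (by simp)
  refine (h.congr_deriv (by simp)).congr_of_eventuallyEq (Filter.Eventually.of_forall fun ε => ?_)
  simp only [Function.comp_apply]
  congr 1
  module

/-- Right multiplication makes `A` a bimodule; the exponential in the square-zero extension
`A ⊕ A` is `X + X' ↦ exp X + dexp X X'`. -/
theorem exp_trivSqZeroExt (X X' : A) :
    NormedSpace.exp (TrivSqZeroExt.inl X + TrivSqZeroExt.inr X' : TrivSqZeroExt A A) =
      TrivSqZeroExt.inl (NormedSpace.exp X) + TrivSqZeroExt.inr (dexp X X') := by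
  -- The first projection is a continuous algebra homomorphism, so it commutes with the exponential.
  have hfst : ∀ Z : TrivSqZeroExt A A,
      (NormedSpace.exp Z).fst = NormedSpace.exp Z.fst := by
    intro Z
    let +nondep : NormedAlgebra ℚ A := .restrictScalars ℚ ℝ A
    let +nondep : NormedAlgebra ℚ (TrivSqZeroExt A A) :=
      .restrictScalars ℚ ℝ (TrivSqZeroExt A A)
    exact NormedSpace.map_exp (TrivSqZeroExt.fstHom ℝ A A) TrivSqZeroExt.continuous_fst Z
  -- Here the difference of the exponents lies in the square-zero ideal, so the two exponentials in
  -- Duhamel's formula act only through their first components.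
  have h := exp_sub_exp (TrivSqZeroExt.inl X + TrivSqZeroExt.inr X' : TrivSqZeroExt A A)
    (TrivSqZeroExt.inl X)
  have hi : ∀ s : ℝ, NormedSpace.exp ((1 - s) •
        (TrivSqZeroExt.inl X + TrivSqZeroExt.inr X' : TrivSqZeroExt A A)) *
      (TrivSqZeroExt.inl X + TrivSqZeroExt.inr X' - TrivSqZeroExt.inl X) *
      NormedSpace.exp (s • TrivSqZeroExt.inl X) =
      TrivSqZeroExt.inr (NormedSpace.exp ((1 - s) • X) * X' * NormedSpace.exp (s • X)) := by
    intro s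
    ext
    · simp [hfst]
    · simp [hfst]
  simp only [hi] at h
  have h2 : ∫ s in (0 : ℝ)..1, (TrivSqZeroExt.inr
      (NormedSpace.exp ((1 - s) • X) * X' * NormedSpace.exp (s • X)) : TrivSqZeroExt A A) =
      TrivSqZeroExt.inr (dexp X X') := by
    have hc : Continuous fun s : ℝ =>
        NormedSpace.exp ((1 - s) • X) * X' * NormedSpace.exp (s • X) :=
      ((continuous_exp_comp (by fun_prop)).mul continuous_const).mul
        (continuous_exp_comp (by fun_prop))
    let L : A →L[ℝ] TrivSqZeroExt A A :=
      { toFun := TrivSqZeroExt.inr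
        map_add' := TrivSqZeroExt.inr_add A
        map_smul' := TrivSqZeroExt.inr_smul A
        cont := TrivSqZeroExt.continuous_inr }
    exact L.intervalIntegral_comp_comm (a := (0 : ℝ)) (b := 1)
      (μ := MeasureTheory.volume) (hc.intervalIntegrable _ _)
  let +nondep : NormedAlgebra ℚ A := .restrictScalars ℚ ℝ A
  rw [h2, TrivSqZeroExt.exp_inl] at h
  rw [sub_eq_iff_eq_add] at h
  rw [h, add_comm]

end Duhamel

end NCTorus

namespace NCTorus

/-! ### The commutant of the right shifts -/

/-- The standard basis vector `e_q`. -/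
noncomputable def basisVec (q : ℤ × ℤ) : Hilb := lp.single 2 q (1 : ℂ)

theorem basisVec_apply (q k : ℤ × ℤ) : basisVec q k = if k = q then 1 else 0 := by
  simp [basisVec, lp.single_apply, Pi.single_apply]

theorem phaseShift_apply (p : ℤ × ℤ) (c : ℤ × ℤ → Circle) (ψ : Hilb) (k : ℤ × ℤ) :
    phaseShift p c ψ k = (c (k - p) : ℂ) * ψ (k - p) := rfl

theorem phaseShift_basisVec (p : ℤ × ℤ) (c : ℤ × ℤ → Circle) (q : ℤ × ℤ) :
    phaseShift p c (basisVec q) = (c q : ℂ) • basisVec (q + p) := by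
  ext k
  rw [phaseShift_apply, lp.coeFn_smul, Pi.smul_apply, basisVec_apply, basisVec_apply,
    smul_eq_mul]
  by_cases hk : k = q + p
  · subst hk; simp
  · rw [if_neg hk, if_neg (by rwa [sub_eq_iff_eq_add]), mul_zero, mul_zero]

theorem phaseShift_mul (p p' : ℤ × ℤ) (c c' : ℤ × ℤ → Circle) :
    phaseShift p c * phaseShift p' c' = phaseShift (p + p') fun k => c (k + p') * c' k := by
  ext ψ k
  change phaseShift p c (phaseShift p' c' ψ) k = _
  rw [phaseShift_apply, phaseShift_apply, phaseShift_apply, ← sub_sub, sub_right_comm k p p',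
    ← sub_right_comm k p p', sub_add_cancel, Circle.coe_mul, mul_assoc]

/-- Integer powers of the generators are computed by exhibiting a family that is additive in the
exponent. -/
theorem eq_zpow_of_map_add {G : Type*} [Group G] (F : ℤ → G)
    (hF : ∀ m n, F (m + n) = F m * F n) (n : ℤ) : F n = F 1 ^ n := by
  let f : Multiplicative ℤ →* G := MonoidHom.mk' (fun n => F n.toAdd) fun a b => hF _ _
  have := map_zpow f (Multiplicative.ofAdd 1) n
  rw [← ofAdd_zsmul] at this
  simpa [f] using this

/-- The bicharacter with `e_q ↦ w(p, q) e_{q+p}` under `U^n V^m`, `p = (n, m)`. -/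
noncomputable def phase (θ : ℝ) (p q : ℤ × ℤ) : Circle := Circle.exp (-(θ * p.2 * q.1))

theorem phase_add_left (θ : ℝ) (p p' q : ℤ × ℤ) :
    phase θ (p + p') q = phase θ p q * phase θ p' q := by
  rw [phase, phase, phase, ← Circle.exp_add]
  congr 1
  push_cast [Prod.snd_add]
  ring

theorem phase_add_right (θ : ℝ) (p q q' : ℤ × ℤ) :
    phase θ p (q + q') = phase θ p q * phase θ p q' := by
  rw [phase, phase, phase, ← Circle.exp_add]
  congr 1
  push_cast [Prod.fst_add]
  ring

@[simp] theorem phase_zero_left (θ : ℝ) (q : ℤ × ℤ) : phase θ 0 q = 1 := by simp [phase]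

@[simp] theorem phase_zero_right (θ : ℝ) (q : ℤ × ℤ) : phase θ q 0 = 1 := by simp [phase]

theorem genU_zpow (n : ℤ) : genU ^ n = phaseShift (n, 0) fun _ => 1 := by
  refine (eq_zpow_of_map_add (fun n : ℤ => phaseShift (n, 0) fun _ => 1) (fun m n => ?_) n).symm
  rw [phaseShift_mul]
  simp

theorem genV_zpow (θ : ℝ) (m : ℤ) : genV θ ^ m = phaseShift (0, m) (phase θ (0, m)) := by
  have h1 : genV θ = phaseShift (0, 1) (phase θ (0, 1)) := by
    unfold genV
    congr 1
    ext k
    simp [phase]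
  rw [h1]
  refine (eq_zpow_of_map_add (fun m : ℤ => phaseShift (0, m) (phase θ (0, m)))
    (fun m n => ?_) m).symm
  rw [phaseShift_mul]
  have : ((0, m + n) : ℤ × ℤ) = (0, m) + (0, n) := by simp
  rw [this]
  congr 1
  ext1 k
  rw [phase_add_left, phase_add_right]
  simp [phase]

theorem monomial_apply (θ : ℝ) (p : ℤ × ℤ) (ψ : Hilb) (k : ℤ × ℤ) :
    monomial θ p ψ k = (phase θ p (k - p) : ℂ) * ψ (k - p) := by
  have : monomial θ p ψ = phaseShift p (phase θ p) ψ := by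
    change (genU ^ p.1 * genV θ ^ p.2) ψ = _
    rw [genU_zpow, genV_zpow, phaseShift_mul]
    have h2 : ((p.1, 0) + (0, p.2) : ℤ × ℤ) = p := by ext <;> simp
    rw [h2]
    congr 2
    ext k
    simp [phase]
  rw [this, phaseShift_apply]

theorem monomial_basisVec (θ : ℝ) (p q : ℤ × ℤ) :
    monomial θ p (basisVec q) = (phase θ p q : ℂ) • basisVec (q + p) := by
  rw [← phaseShift_basisVec]
  ext k
  rw [monomial_apply, phaseShift_apply]

theorem norm_monomial_le (θ : ℝ) (p : ℤ × ℤ) : ‖monomial θ p‖ ≤ 1 :=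
  ContinuousLinearMap.opNorm_le_bound _ zero_le_one fun ψ => by
    rw [one_mul]
    exact (LinearIsometryEquiv.norm_map _ ψ).le

theorem coeff_def (x : Op) (p : ℤ × ℤ) : coeff x p = x (basisVec 0) p := rfl

/-- The evaluation of a coordinate as a continuous functional. -/
noncomputable def coordCLM (p : ℤ × ℤ) : Hilb →L[ℂ] ℂ :=
  LinearMap.mkContinuous
    { toFun := fun ψ => ψ p, map_add' := fun _ _ => rfl, map_smul' := fun _ _ => rfl } 1
    fun ψ => by rw [one_mul]; exact lp.norm_apply_le_norm (by norm_num) ψ p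

@[simp] theorem coordCLM_apply (p : ℤ × ℤ) (ψ : Hilb) : coordCLM p ψ = ψ p := rfl

/-- The coefficient `a_p` as a continuous functional. -/
noncomputable def coeffCLM (p : ℤ × ℤ) : Op →L[ℂ] ℂ :=
  (coordCLM p).comp (ContinuousLinearMap.apply ℂ Hilb (basisVec 0))

@[simp] theorem coeffCLM_apply (p : ℤ × ℤ) (x : Op) : coeffCLM p x = coeff x p := rfl

theorem norm_coeff_le (x : Op) (p : ℤ × ℤ) : ‖coeff x p‖ ≤ ‖x‖ := by
  refine (lp.norm_apply_le_norm (by norm_num) (x (basisVec 0)) p).trans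
    ((x.le_opNorm _).trans ?_)
  rw [basisVec, lp.norm_single (by norm_num)]
  simp

theorem hasSum_apply (x : Op) (ψ : Hilb) (p : ℤ × ℤ) :
    HasSum (fun q => x (basisVec q) p * ψ q) (x ψ p) := by
  have h := (lp.hasSum_single (p := 2) (by norm_num) ψ).mapL ((coordCLM p).comp x)
  refine HasSum.congr_fun (a := x ψ p) h fun q => ?_
  have h1 : (lp.single 2 q (ψ q) : Hilb) = ψ q • basisVec q := by
    rw [basisVec, ← lp.single_smul, smul_eq_mul, mul_one]
  rw [h1, map_smul, smul_eq_mul, mul_comm]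
  rfl

/-- The commutant of the right regular representation. -/
noncomputable def commutant (θ : ℝ) : Subalgebra ℂ Op :=
  Subalgebra.centralizer ℂ (Set.range fun q : ℤ × ℤ =>
    ((phaseShift q fun k => phase θ k q : Hilb ≃ₗᵢ[ℂ] Hilb) : Hilb →L[ℂ] Hilb))

theorem isClosed_commutant (θ : ℝ) : IsClosed (commutant θ : Set Op) :=
  Set.isClosed_centralizer _

theorem mem_commutant {θ : ℝ} {x : Op} : x ∈ commutant θ ↔ ∀ (q : ℤ × ℤ) (ψ : Hilb),
    phaseShift q (fun k => phase θ k q) (x ψ) = x (phaseShift q (fun k => phase θ k q) ψ) := by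
  rw [commutant, Subalgebra.mem_centralizer_iff]
  simp only [Set.forall_mem_range]
  exact forall_congr' fun q => ContinuousLinearMap.ext_iff

/-- Left and right shifts commute because `phase` is a bicharacter: in either order the phases
picked up differ from the separate ones by the same factor `phase θ p q`. -/
theorem monomial_mem_commutant (θ : ℝ) (p : ℤ × ℤ) : monomial θ p ∈ commutant θ := by
  rw [mem_commutant]
  intro q ψ
  ext k
  rw [phaseShift_apply, monomial_apply, monomial_apply, phaseShift_apply, sub_right_comm k p q]
  have h1 : k - q = (k - q - p) + p := by abel
  have h2 : k - p = (k - q - p) + q := by abel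
  conv_lhs => rw [h1]
  rw [h2, phase_add_left, phase_add_right]
  simp only [Circle.coe_mul, add_sub_cancel_right]
  ring

/-- The vector `e_q` is the right shift of `e_0`, so the first column of an operator in the
commutant determines its whole matrix. This is what makes coefficients faithful there. -/
theorem apply_basisVec_of_mem_commutant {θ : ℝ} {x : Op} (hx : x ∈ commutant θ) (p q : ℤ × ℤ) :
    x (basisVec q) p = (phase θ (p - q) q : ℂ) * coeff x (p - q) := by
  have h := mem_commutant.1 hx q (basisVec 0)
  rw [phaseShift_basisVec] at h
  simp only [phase_zero_left, Circle.coe_one, one_smul, zero_add] at h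
  rw [← h, phaseShift_apply, coeff_def]

theorem eq_of_coeff_eq {θ : ℝ} {x y : Op} (hx : x ∈ commutant θ) (hy : y ∈ commutant θ)
    (h : ∀ p, coeff x p = coeff y p) : x = y := by
  ext ψ p
  refine (hasSum_apply x ψ p).unique ?_
  convert hasSum_apply y ψ p using 2 with q
  rw [apply_basisVec_of_mem_commutant hx, apply_basisVec_of_mem_commutant hy, h]

/-- Composition becomes a twisted convolution of coefficients. Only the left factor has to lie in
the commutant. -/
theorem hasSum_coeff_mul {θ : ℝ} {x : Op} (hx : x ∈ commutant θ) (y : Op) (p : ℤ × ℤ) :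
    HasSum (fun q => (phase θ (p - q) q : ℂ) * coeff x (p - q) * coeff y q)
      (coeff (x * y) p) := by
  have h := hasSum_apply x (y (basisVec 0)) p
  simp only [apply_basisVec_of_mem_commutant hx] at h
  exact h

theorem coeff_monomial (θ : ℝ) (p q : ℤ × ℤ) :
    coeff (monomial θ p) q = if q = p then 1 else 0 := by
  rw [coeff_def, monomial_basisVec]
  simp [basisVec_apply]

/-- The trace property. -/
theorem trace_mul_comm {θ : ℝ} {x y : Op} (hx : x ∈ commutant θ) (hy : y ∈ commutant θ) :
    trace (x * y) = trace (y * x) := by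
  have h1 := hasSum_coeff_mul hx y 0
  have h2 := hasSum_coeff_mul hy x 0
  refine h1.unique ?_
  -- The substitution `q ↦ -q` exchanges the roles of the two factors, and the phase is unaffected
  -- when the sign moves from one argument to the other.
  have h3 := (Equiv.neg (ℤ × ℤ)).hasSum_iff.2 h2
  refine h3.congr_fun fun q => ?_
  simp only [Function.comp_apply, Equiv.neg_apply, zero_sub, neg_neg]
  have : phase θ (-q) q = phase θ q (-q) := by simp [phase]
  rw [this]
  ring

/-- The exponent 4 comes from `(1+a)(1+b) ≤ (1+a+b)²`: squaring compares the weight with a product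
of two summable one-variable weights. -/
theorem summable_weight : Summable fun p : ℤ × ℤ => ((1 + |(p.1 : ℝ)| + |(p.2 : ℝ)|) ^ 4)⁻¹ := by
  have h1 : Summable fun n : ℤ => ((1 + |(n : ℝ)|) ^ 2)⁻¹ := by
    have h2 : Summable fun n : ℤ => 1 / (n : ℝ) ^ 2 :=
      Real.summable_one_div_int_pow.2 (by norm_num)
    refine h2.of_norm_bounded_eventually ?_
    filter_upwards [Filter.eventually_cofinite_ne (0 : ℤ)] with n hn
    have hn' : 0 < |(n : ℝ)| := by positivity
    rw [Real.norm_of_nonneg (by positivity), one_div, ← sq_abs (n : ℝ)]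
    gcongr
    linarith
  refine (h1.mul_of_nonneg h1 (fun _ => by positivity) fun _ => by positivity).of_nonneg_of_le
    (fun _ => by positivity) fun p => ?_
  have ha := abs_nonneg (p.1 : ℝ)
  have hb := abs_nonneg (p.2 : ℝ)
  rw [← mul_inv, ← mul_pow, show 4 = 2 * 2 from rfl, pow_mul]
  gcongr
  nlinarith

theorem RapidDecay.summable {a : ℤ × ℤ → ℂ} (ha : RapidDecay a) (θ : ℝ) :
    Summable fun p => a p • monomial θ p := by
  obtain ⟨C, hC⟩ := ha 4
  refine Summable.of_norm_bounded (summable_weight.mul_left C) fun p => ?_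
  have hpos : 0 < (1 + |(p.1 : ℝ)| + |(p.2 : ℝ)|) ^ 4 := by positivity
  rw [norm_smul, ← div_eq_mul_inv, le_div_iff₀ hpos, mul_comm]
  refine le_trans ?_ (hC p)
  gcongr
  exact mul_le_of_le_one_right (norm_nonneg _) (norm_monomial_le θ p)

theorem mem_commutant_of_hasSum {θ : ℝ} {a : ℤ × ℤ → ℂ} {x : Op}
    (hx : HasSum (fun p => a p • monomial θ p) x) : x ∈ commutant θ :=
  (isClosed_commutant θ).mem_of_tendsto hx (Filter.Eventually.of_forall fun _ =>
    Subalgebra.sum_mem _ fun p _ => Subalgebra.smul_mem _ (monomial_mem_commutant θ p) _)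

theorem coeff_of_hasSum {θ : ℝ} {a : ℤ × ℤ → ℂ} {x : Op}
    (hx : HasSum (fun p => a p • monomial θ p) x) : coeff x = a := by
  ext q
  have h1 := hx.mapL (coeffCLM q)
  refine h1.unique ?_
  convert hasSum_ite_eq q (a q) using 2 with p
  simp only [map_smul, coeffCLM_apply, coeff_monomial]
  by_cases h : q = p
  · subst h; simp
  · simp [h, Ne.symm h]

/-- The series built from rapidly decaying coefficients converges to an element of the commutant
with those same coefficients, hence to the given operator. Membership can thus be tested without
handling series. -/
theorem mem_smoothTorus_iff {θ : ℝ} {x : Op} :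
    x ∈ smoothTorus θ ↔ x ∈ commutant θ ∧ RapidDecay (coeff x) := by
  constructor
  · rintro ⟨a, ha, hx⟩
    exact ⟨mem_commutant_of_hasSum hx, (coeff_of_hasSum hx).symm ▸ ha⟩
  · rintro ⟨h1, h2⟩
    have hs := (h2.summable θ).hasSum
    refine ⟨coeff x, h2, ?_⟩
    convert hs using 1
    exact eq_of_coeff_eq h1 (mem_commutant_of_hasSum hs) fun p => by rw [coeff_of_hasSum hs]

theorem RapidDecay.add {a b : ℤ × ℤ → ℂ} (ha : RapidDecay a) (hb : RapidDecay b) :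
    RapidDecay (a + b) := by
  intro k
  obtain ⟨C, hC⟩ := ha k
  obtain ⟨D, hD⟩ := hb k
  refine ⟨C + D, fun p => (mul_le_mul_of_nonneg_left (norm_add_le _ _) (by positivity)).trans ?_⟩
  rw [mul_add]
  exact add_le_add (hC p) (hD p)

theorem RapidDecay.smul {a : ℤ × ℤ → ℂ} (ha : RapidDecay a) (z : ℂ) :
    RapidDecay (z • a) := by
  intro k
  obtain ⟨C, hC⟩ := ha k
  refine ⟨‖z‖ * C, fun p => ?_⟩
  rw [Pi.smul_apply, norm_smul, mul_left_comm]
  exact mul_le_mul_of_nonneg_left (hC p) (norm_nonneg _)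

theorem add_mem_smoothTorus {θ : ℝ} {x y : Op} (hx : x ∈ smoothTorus θ)
    (hy : y ∈ smoothTorus θ) : x + y ∈ smoothTorus θ := by
  rw [mem_smoothTorus_iff] at *
  exact ⟨add_mem hx.1 hy.1, hx.2.add hy.2⟩

theorem smul_mem_smoothTorus {θ : ℝ} {x : Op} (hx : x ∈ smoothTorus θ) (z : ℂ) :
    z • x ∈ smoothTorus θ := by
  rw [mem_smoothTorus_iff] at *
  exact ⟨Subalgebra.smul_mem _ hx.1 _, hx.2.smul z⟩

theorem monomial_mem_smoothTorus (θ : ℝ) (p : ℤ × ℤ) : monomial θ p ∈ smoothTorus θ := by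
  refine mem_smoothTorus_iff.2 ⟨monomial_mem_commutant θ p, fun k =>
    ⟨(1 + |(p.1 : ℝ)| + |(p.2 : ℝ)|) ^ k, fun q => ?_⟩⟩
  rw [coeff_monomial]
  split_ifs with h
  · rw [h]; simp
  · simp; positivity

/-- A monomial is isometric, so its adjoint is a left inverse; the right-hand side is a right
inverse, and the two must agree. -/
theorem star_monomial (θ : ℝ) (p : ℤ × ℤ) :
    star (monomial θ p) = (phase θ p p : ℂ) • monomial θ (-p) := by
  have h1 : star (monomial θ p) * monomial θ p = 1 :=
    (ContinuousLinearMap.norm_map_iff_adjoint_comp_self _).1 fun ψ =>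
      LinearIsometryEquiv.norm_map _ ψ
  have h2 : monomial θ p * ((phase θ p p : ℂ) • monomial θ (-p)) = 1 := by
    ext ψ k
    rw [mul_smul_comm]
    change (phase θ p p : ℂ) * monomial θ p (monomial θ (-p) ψ) k = ψ k
    rw [monomial_apply, monomial_apply, ← mul_assoc, ← mul_assoc, ← Circle.coe_mul,
      ← Circle.coe_mul]
    have h3 : phase θ p p * phase θ p (k - p) * phase θ (-p) (k - p - -p) = 1 := by
      rw [← phase_add_right, add_sub_cancel, sub_neg_eq_add, sub_add_cancel, ← phase_add_left,
        add_neg_cancel, phase_zero_left]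
    rw [h3, Circle.coe_one, one_mul, sub_neg_eq_add, sub_add_cancel]
  calc star (monomial θ p)
      = star (monomial θ p) * (monomial θ p * ((phase θ p p : ℂ) • monomial θ (-p))) := by
        rw [h2, mul_one]
    _ = _ := by rw [← mul_assoc, h1, one_mul]

theorem star_mem_smoothTorus_monomial (θ : ℝ) (p : ℤ × ℤ) :
    star (monomial θ p) ∈ smoothTorus θ := by
  rw [star_monomial]
  exact smul_mem_smoothTorus (monomial_mem_smoothTorus θ _) _

/-- The trace separates the points of the smooth algebra. -/
theorem eq_zero_of_trace_mul_eq_zero {θ : ℝ} {x : Op} (hx : x ∈ commutant θ)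
    (h : ∀ a ∈ smoothTorus θ, IsSelfAdjoint a → trace (x * a) = 0) : x = 0 := by
  have hlin : ∀ a ∈ smoothTorus θ, star a ∈ smoothTorus θ → trace (x * a) = 0 := by
    intro a ha ha'
    have h1 := h (a + star a) (add_mem_smoothTorus ha ha') (IsSelfAdjoint.add_star_self a)
    -- The self-adjoint elements `a + a*` and `ia + (ia)*` together isolate the pairing with `a`
    -- itself.
    have h2 := h (I • a + star (I • a))
      (add_mem_smoothTorus (smul_mem_smoothTorus ha _) (by
        rw [star_smul]; exact smul_mem_smoothTorus ha' _)) (IsSelfAdjoint.add_star_self _)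
    have e1 : trace (x * (a + star a)) = trace (x * a) + trace (x * star a) := by
      rw [mul_add]; exact map_add (coeffCLM 0) _ _
    have e2 : trace (x * (I • a + star (I • a))) =
        I * trace (x * a) + star I * trace (x * star a) := by
      rw [mul_add, star_smul, mul_smul_comm, mul_smul_comm]
      refine (map_add (coeffCLM 0) _ _).trans ?_
      rw [map_smul, map_smul]
      rfl
    rw [e1] at h1
    rw [e2] at h2
    simp only [Complex.star_def, Complex.conj_I] at h2
    have h3 : I * (2 * trace (x * a)) = 0 := by linear_combination h2 + I * h1
    simpa using h3
  refine eq_of_coeff_eq hx (Subalgebra.zero_mem _) fun p => ?_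
  -- Pairing with the monomial of index `-p` reads off the coefficient at `p`, up to a phase of
  -- modulus one.
  have h1 := hlin (monomial θ (-p)) (monomial_mem_smoothTorus _ _)
    (star_mem_smoothTorus_monomial _ _)
  have h2 := hasSum_coeff_mul hx (monomial θ (-p)) 0
  have h3 := h2.unique (hasSum_single (-p) fun q hq => by rw [coeff_monomial, if_neg hq, mul_zero])
  rw [show coeff (x * monomial θ (-p)) 0 = 0 from h1, coeff_monomial, if_pos rfl] at h3
  simpa [coeff_def] using h3.symm

end NCTorus

namespace NCTorus

/-! ### The basic derivations -/

/-- The exponent of the `j`-th generator. -/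
def expo (j : Fin 2) (p : ℤ × ℤ) : ℤ := ![p.1, p.2] j

theorem expo_add (j : Fin 2) (p q : ℤ × ℤ) : expo j (p + q) = expo j p + expo j q := by
  fin_cases j <;> rfl

theorem expo_zero (j : Fin 2) : expo j 0 = 0 := by
  fin_cases j <;> rfl

theorem abs_expo_le (j : Fin 2) (p : ℤ × ℤ) :
    |(expo j p : ℝ)| ≤ 1 + |(p.1 : ℝ)| + |(p.2 : ℝ)| := by
  have ha := abs_nonneg (p.1 : ℝ)
  have hb := abs_nonneg (p.2 : ℝ)
  fin_cases j <;> simp [expo] <;> linarith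

/-- `x` and `y` lie in the commutant of the right shifts, and `y = ∇_j x` coefficientwise. -/
structure IsDer (θ : ℝ) (j : Fin 2) (x y : Op) : Prop where
  left_mem : x ∈ commutant θ
  right_mem : y ∈ commutant θ
  coeff_eq : ∀ p, coeff y p = I * (expo j p : ℂ) * coeff x p

namespace IsDer

variable {θ : ℝ} {j : Fin 2} {x x' y y' : Op}

theorem unique (h : IsDer θ j x y) (h' : IsDer θ j x y') : y = y' :=
  eq_of_coeff_eq h.right_mem h'.right_mem fun p => by rw [h.coeff_eq, h'.coeff_eq]

theorem add (h : IsDer θ j x x') (h' : IsDer θ j y y') : IsDer θ j (x + y) (x' + y') where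
  left_mem := add_mem h.left_mem h'.left_mem
  right_mem := add_mem h.right_mem h'.right_mem
  coeff_eq p := by
    have e : ∀ u v : Op, coeff (u + v) p = coeff u p + coeff v p := map_add (coeffCLM p)
    rw [e, e, h.coeff_eq, h'.coeff_eq, mul_add]

theorem smul (h : IsDer θ j x x') (z : ℂ) : IsDer θ j (z • x) (z • x') where
  left_mem := Subalgebra.smul_mem _ h.left_mem _
  right_mem := Subalgebra.smul_mem _ h.right_mem _
  coeff_eq p := by
    have e : ∀ u : Op, coeff (z • u) p = z * coeff u p := map_smul (coeffCLM p) z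
    rw [e, e, h.coeff_eq, mul_left_comm]

/-- The Leibniz rule holds because the exponent is additive over the indices `p - q` and `q` that
meet in the convolution. -/
theorem mul (h : IsDer θ j x x') (h' : IsDer θ j y y') :
    IsDer θ j (x * y) (x' * y + x * y') where
  left_mem := mul_mem h.left_mem h'.left_mem
  right_mem := add_mem (mul_mem h.right_mem h'.left_mem) (mul_mem h.left_mem h'.right_mem)
  coeff_eq p := by
    have e : ∀ u v : Op, coeff (u + v) p = coeff u p + coeff v p := map_add (coeffCLM p)
    have h1 := (hasSum_coeff_mul h.right_mem y p).add (hasSum_coeff_mul h.left_mem y' p)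
    have h2 := (hasSum_coeff_mul h.left_mem y p).mul_left (I * (expo j p : ℂ))
    rw [e]
    refine h1.unique (h2.congr_fun fun q => ?_)
    rw [h.coeff_eq, h'.coeff_eq]
    have : expo j p = expo j (p - q) + expo j q := by rw [← expo_add, sub_add_cancel]
    rw [this]
    push_cast
    ring

theorem one : IsDer θ j 1 0 where
  left_mem := one_mem _
  right_mem := zero_mem _
  coeff_eq p := by
    have h0 : coeff 0 p = 0 := map_zero (coeffCLM p)
    rw [h0, coeff_def, one_apply_eq_self, basisVec_apply]
    split_ifs with h
    · subst h; simp [expo_zero]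
    · simp

/-- Integration by parts. -/
theorem trace_mul (h : IsDer θ j x x') (h' : IsDer θ j y y') :
    trace (x' * y) = -trace (x * y') := by
  have h1 := (h.mul h').coeff_eq 0
  have e : coeff (x' * y + x * y') 0 = coeff (x' * y) 0 + coeff (x * y') 0 :=
    map_add (coeffCLM 0) _ _
  rw [e, expo_zero] at h1
  rw [trace, trace, eq_neg_iff_add_eq_zero, h1]
  simp

/-- A pair `(x, ∇x)` is an element of the square-zero extension, whose product encodes the Leibniz
rule. The partial sums of its exponential series are again such pairs, and the relation survives the
limit because coefficients are continuous and the commutant is closed. No boundedness of `∇` is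
needed. -/
theorem exp (h : IsDer θ j x x') : IsDer θ j (NormedSpace.exp x) (dexp x x') := by
  set z : TrivSqZeroExt Op Op := TrivSqZeroExt.inl x + TrivSqZeroExt.inr x' with hz
  have hpow : ∀ n : ℕ, IsDer θ j (z ^ n).fst (z ^ n).snd := by
    intro n
    induction n with
    | zero =>
      change IsDer θ j 1 0
      exact one
    | succ n ih =>
      have e : z ^ (n + 1) = z ^ n * z := pow_succ z n
      rw [e]
      have hzz : IsDer θ j z.fst z.snd := by simpa [hz] using h
      have := ih.mul hzz
      rw [add_comm] at this
      exact this
  have hexp : NormedSpace.exp z =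
      TrivSqZeroExt.inl (NormedSpace.exp x) + TrivSqZeroExt.inr (dexp x x') :=
    exp_trivSqZeroExt x x'
  have hs := NormedSpace.exp_series_hasSum_exp' (𝕂 := ℂ) z
  rw [hexp] at hs
  have hfin : ∀ s : Finset ℕ, IsDer θ j (∑ n ∈ s, ((Nat.factorial n : ℂ)⁻¹ • z ^ n)).fst
      (∑ n ∈ s, ((Nat.factorial n : ℂ)⁻¹ • z ^ n)).snd := by
    intro s
    induction s using Finset.induction_on with
    | empty =>
      simpa using (one (θ := θ) (j := j)).smul 0
    | insert a s ha ih =>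
      rw [Finset.sum_insert ha]
      exact ((hpow a).smul _).add ih
  have t1 : Filter.Tendsto (fun s : Finset ℕ =>
      (∑ n ∈ s, ((Nat.factorial n : ℂ)⁻¹ • z ^ n)).fst) Filter.atTop
      (nhds (NormedSpace.exp x)) := by
    have := (TrivSqZeroExt.continuous_fst.tendsto _).comp hs
    simp only [TrivSqZeroExt.fst_add, TrivSqZeroExt.fst_inl, TrivSqZeroExt.fst_inr,
      add_zero] at this
    exact this
  have t2 : Filter.Tendsto (fun s : Finset ℕ =>
      (∑ n ∈ s, ((Nat.factorial n : ℂ)⁻¹ • z ^ n)).snd) Filter.atTop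
      (nhds (dexp x x')) := by
    have := (TrivSqZeroExt.continuous_snd.tendsto _).comp hs
    simp only [TrivSqZeroExt.snd_add, TrivSqZeroExt.snd_inl, TrivSqZeroExt.snd_inr,
      zero_add] at this
    exact this
  refine ⟨(isClosed_commutant θ).mem_of_tendsto t1 (.of_forall fun s => (hfin s).left_mem),
    (isClosed_commutant θ).mem_of_tendsto t2 (.of_forall fun s => (hfin s).right_mem),
    fun p => ?_⟩
  refine tendsto_nhds_unique (((coeffCLM p).continuous.tendsto _).comp t2) ?_
  refine ((((coeffCLM p).continuous.tendsto _).comp t1).const_mul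
    (I * (expo j p : ℂ))).congr fun s => ?_
  exact ((hfin s).coeff_eq p).symm

end IsDer

theorem RapidDecay.deriv {a : ℤ × ℤ → ℂ} (ha : RapidDecay a) (j : Fin 2) :
    RapidDecay fun p => I * (expo j p : ℂ) * a p := by
  intro k
  obtain ⟨C, hC⟩ := ha (k + 1)
  refine ⟨C, fun p => le_trans ?_ (hC p)⟩
  rw [norm_mul, norm_mul, Complex.norm_I, one_mul, pow_succ, mul_assoc]
  have : ‖(expo j p : ℂ)‖ ≤ 1 + |(p.1 : ℝ)| + |(p.2 : ℝ)| := by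
    rw [Complex.norm_intCast]; exact abs_expo_le j p
  gcongr

theorem isDer_basicDeriv {θ : ℝ} (j : Fin 2) {x : Op} (hx : x ∈ smoothTorus θ) :
    IsDer θ j x (basicDeriv θ j x) := by
  rw [mem_smoothTorus_iff] at hx
  have hs := ((hx.2.deriv j).summable θ).hasSum
  exact ⟨hx.1, mem_commutant_of_hasSum hs, fun p => congrFun (coeff_of_hasSum hs) p⟩

theorem basicDeriv_mem {θ : ℝ} (j : Fin 2) {x : Op} (hx : x ∈ smoothTorus θ) :
    basicDeriv θ j x ∈ smoothTorus θ := by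
  have h := isDer_basicDeriv j hx
  rw [mem_smoothTorus_iff] at hx ⊢
  refine ⟨h.right_mem, ?_⟩
  rw [show coeff (basicDeriv θ j x) = _ from funext h.coeff_eq]
  exact hx.2.deriv j

theorem real_smul_eq (t : ℝ) (x : Op) : t • x = (t : ℂ) • x :=
  (Complex.coe_smul t x).symm

theorem basicDeriv_add_smul {θ : ℝ} (j : Fin 2) {x y : Op} (hx : x ∈ smoothTorus θ)
    (hy : y ∈ smoothTorus θ) (t : ℝ) :
    basicDeriv θ j (x + t • y) = basicDeriv θ j x + t • basicDeriv θ j y := by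
  rw [real_smul_eq, real_smul_eq]
  exact (isDer_basicDeriv j (add_mem_smoothTorus hx (smul_mem_smoothTorus hy _))).unique
    ((isDer_basicDeriv j hx).add ((isDer_basicDeriv j hy).smul _))

/-- A criterion for smoothness. -/
theorem mem_smoothTorus_of_forall {θ : ℝ} {x : Op} (hx : x ∈ commutant θ)
    (h : ∀ (j : Fin 2) (k : ℕ), ∃ y : Op, ∀ p, coeff y p = (I * (expo j p : ℂ)) ^ k * coeff x p) :
    x ∈ smoothTorus θ := by
  have hb : ∀ (j : Fin 2) (k : ℕ), ∃ C : ℝ, ∀ p, |(expo j p : ℝ)| ^ k * ‖coeff x p‖ ≤ C := by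
    intro j k
    -- Each coefficient is bounded by the operator norm, so a bounded `k`-fold derivative bounds the
    -- `k`-th moment in direction `j`.
    obtain ⟨y, hy⟩ := h j k
    refine ⟨‖y‖, fun p => ?_⟩
    have := norm_coeff_le y p
    rw [hy, norm_mul, norm_pow, norm_mul, Complex.norm_I, one_mul, Complex.norm_intCast] at this
    exact this
  refine mem_smoothTorus_iff.2 ⟨hx, fun k => ?_⟩
  obtain ⟨C, hC⟩ := hb 0 k
  obtain ⟨D, hD⟩ := hb 1 k
  refine ⟨3 ^ k * (‖x‖ + C + D), fun p => ?_⟩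
  have hc := hC p
  have hd := hD p
  have hx := norm_coeff_le x p
  simp only [expo, Matrix.cons_val_zero, Matrix.cons_val_one] at hc hd
  have ha := abs_nonneg (p.1 : ℝ)
  have hb := abs_nonneg (p.2 : ℝ)
  have hn := norm_nonneg (coeff x p)
  set a := |(p.1 : ℝ)|
  set b := |(p.2 : ℝ)|
  have key : (1 + a + b) ^ k ≤ 3 ^ k * (1 + a ^ k + b ^ k) := by
    have h1 : 1 + a + b ≤ 3 * max 1 (max a b) := by
      have := le_max_left 1 (max a b)
      have := (le_max_left a b).trans (le_max_right 1 (max a b))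
      have := (le_max_right a b).trans (le_max_right 1 (max a b))
      linarith
    refine (pow_le_pow_left₀ (by positivity) h1 k).trans ?_
    rw [mul_pow]
    gcongr
    have ha' := pow_nonneg ha k
    have hb' := pow_nonneg hb k
    rcases max_choice 1 (max a b) with h | h <;> rw [h]
    · rw [one_pow]; linarith
    · rcases max_choice a b with h | h <;> rw [h] <;> linarith
  calc (1 + a + b) ^ k * ‖coeff x p‖ ≤ 3 ^ k * (1 + a ^ k + b ^ k) * ‖coeff x p‖ := by gcongr
    _ = 3 ^ k * (‖coeff x p‖ + a ^ k * ‖coeff x p‖ + b ^ k * ‖coeff x p‖) := by ring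
    _ ≤ _ := by gcongr

end NCTorus

namespace NCTorus

/-! ### Smoothness of rearrangement operators -/

/-- The one-parameter group `e^{ith}`. -/
noncomputable def unitaryGroup (h : Op) (t : ℝ) : Op := NormedSpace.exp ((I * t) • h)

theorem continuous_unitaryGroup (h : Op) : Continuous (unitaryGroup h) :=
  continuous_exp_comp (by fun_prop)

instance : Nontrivial Op := ⟨1, 0, fun h => by
  have := congrArg (fun x : Op => coeff x 0) h
  simp [coeff_def, basisVec_apply] at this⟩

theorem norm_unitaryGroup_le {h : Op} (hsa : IsSelfAdjoint h) (t : ℝ) :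
    ‖unitaryGroup h t‖ ≤ 1 := by
  have h1 : IsSelfAdjoint (t • h) := by
    rw [real_smul_eq, isSelfAdjoint_iff, star_smul, hsa.star_eq, Complex.star_def,
      Complex.conj_ofReal]
  have h2 : unitaryGroup h t = (selfAdjoint.expUnitary ⟨t • h, selfAdjoint.mem_iff.2 h1⟩ : Op) := by
    rw [selfAdjoint.expUnitary_coe, unitaryGroup, mul_smul, Complex.coe_smul]
    rfl
  rw [h2]
  exact (CStarRing.norm_of_mem_unitary (SetLike.coe_mem _)).le

theorem unitaryGroup_add (h : Op) (s t : ℝ) :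
    unitaryGroup h (s + t) = unitaryGroup h s * unitaryGroup h t := by
  let +nondep : NormedAlgebra ℚ Op := .restrictScalars ℚ ℝ Op
  rw [unitaryGroup, unitaryGroup, unitaryGroup, ← NormedSpace.exp_add_of_commute]
  · congr 1
    push_cast
    module
  · exact ((Commute.refl h).smul_left _).smul_right _

theorem expWord_eq (h : Op) {n : ℕ} (ξ : Fin (n + 1) → ℝ) (ρ : Fin n → Op) :
    expWord h ξ ρ = unitaryGroup h (ξ 0) *
      (List.ofFn fun j : Fin n => ρ j * unitaryGroup h (ξ j.succ)).prod := rfl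

/-- The derivative of `e^{ith}` under a derivation with `h ↦ h'`. -/
theorem dexp_unitaryGroup (h h' : Op) (t : ℝ) :
    dexp ((I * t) • h) ((I * t) • h') = ∫ s in (0 : ℝ)..1,
      (I * t) • (unitaryGroup h ((1 - s) * t) * h' * unitaryGroup h (s * t)) := by
  unfold dexp unitaryGroup
  congr 1
  ext1 s
  rw [mul_smul_comm, smul_mul_assoc]
  have e : ∀ r : ℝ, r • (I * (t : ℂ)) • h = (I * ((r * t : ℝ) : ℂ)) • h := fun r => by
    rw [real_smul_eq r, smul_smul]
    push_cast
    rw [mul_left_comm]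
  congr 3
  · congr 1
    exact e _
  · exact e _

/-! ### Maps of polynomial growth. -/

section Tame

variable {Ω Ω' : Type} [NormedAddCommGroup Ω] [NormedAddCommGroup Ω']

/-- Continuous maps of at most polynomial growth. -/
def PolyBdd {F : Type*} [NormedAddCommGroup F] (E : Ω → F) : Prop :=
  Continuous E ∧ ∃ (C : ℝ) (N : ℕ), ∀ w, ‖E w‖ ≤ C * (1 + ‖w‖) ^ N

theorem PolyBdd.exists_nonneg {F : Type*} [NormedAddCommGroup F] {E : Ω → F} (h : PolyBdd E) :
    ∃ (C : ℝ) (N : ℕ), 0 ≤ C ∧ ∀ w, ‖E w‖ ≤ C * (1 + ‖w‖) ^ N := by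
  obtain ⟨-, C, N, hC⟩ := h
  refine ⟨C, N, ?_, hC⟩
  simpa using (norm_nonneg _).trans (hC 0)

theorem PolyBdd.add {F : Type*} [NormedAddCommGroup F] {E E' : Ω → F} (h : PolyBdd E)
    (h' : PolyBdd E') : PolyBdd fun w => E w + E' w := by
  refine ⟨h.1.add h'.1, ?_⟩
  obtain ⟨C, N, hC0, hC⟩ := h.exists_nonneg
  obtain ⟨D, M, hD0, hD⟩ := h'.exists_nonneg
  refine ⟨C + D, N + M, fun w => (norm_add_le _ _).trans ?_⟩
  have h1 : 1 ≤ 1 + ‖w‖ := by linarith [norm_nonneg w]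
  rw [add_mul]
  refine add_le_add ((hC w).trans ?_) ((hD w).trans ?_) <;> gcongr <;> first | exact h1 | omega

theorem PolyBdd.mul {F : Type*} [NormedRing F] {E E' : Ω → F} (h : PolyBdd E)
    (h' : PolyBdd E') : PolyBdd fun w => E w * E' w := by
  refine ⟨h.1.mul h'.1, ?_⟩
  obtain ⟨C, N, hC0, hC⟩ := h.exists_nonneg
  obtain ⟨D, M, hD0, hD⟩ := h'.exists_nonneg
  refine ⟨C * D, N + M, fun w => (norm_mul_le _ _).trans ?_⟩
  calc ‖E w‖ * ‖E' w‖ ≤ (C * (1 + ‖w‖) ^ N) * (D * (1 + ‖w‖) ^ M) := by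
        gcongr
        · exact hC w
        · exact hD w
    _ = _ := by ring

theorem PolyBdd.smul {F : Type*} [NormedAddCommGroup F] [NormedSpace ℂ F] {c : Ω → ℂ} {E : Ω → F}
    (h : PolyBdd c) (h' : PolyBdd E) : PolyBdd fun w => c w • E w := by
  refine ⟨h.1.smul h'.1, ?_⟩
  obtain ⟨C, N, hC0, hC⟩ := h.exists_nonneg
  obtain ⟨D, M, hD0, hD⟩ := h'.exists_nonneg
  refine ⟨C * D, N + M, fun w => (norm_smul_le _ _).trans ?_⟩
  calc ‖c w‖ * ‖E w‖ ≤ (C * (1 + ‖w‖) ^ N) * (D * (1 + ‖w‖) ^ M) := by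
        gcongr
        · exact hC w
        · exact hD w
    _ = _ := by ring

theorem PolyBdd.const {F : Type*} [NormedAddCommGroup F] (x : F) : PolyBdd fun _ : Ω => x :=
  ⟨continuous_const, ‖x‖, 0, fun w => by simp⟩

theorem PolyBdd.comp {F : Type*} [NormedAddCommGroup F] {E : Ω → F} {g : Ω' → Ω}
    (h : PolyBdd E) (hg : PolyBdd g) : PolyBdd fun w => E (g w) := by
  refine ⟨h.1.comp hg.1, ?_⟩
  obtain ⟨C, N, hC0, hC⟩ := h.exists_nonneg
  obtain ⟨D, M, hD0, hD⟩ := hg.exists_nonneg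
  refine ⟨C * (1 + D) ^ N, M * N, fun w => (hC _).trans ?_⟩
  rw [mul_assoc, pow_mul, ← mul_pow]
  gcongr
  have h1 : 1 ≤ (1 + ‖w‖) ^ M := one_le_pow₀ (by linarith [norm_nonneg w])
  linarith [hD w]

theorem PolyBdd.of_clm [NormedSpace ℝ Ω] {F : Type*} [NormedAddCommGroup F] [NormedSpace ℝ F]
    (L : Ω →L[ℝ] F) : PolyBdd fun w => L w :=
  ⟨L.continuous, ‖L‖, 1, fun w => (L.le_opNorm w).trans (by gcongr; simp)⟩

theorem PolyBdd.intervalIntegral {F : Type*} [NormedAddCommGroup F] [NormedSpace ℝ F]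
    {E : Ω × ℝ → F} (h : PolyBdd E) : PolyBdd fun w => ∫ s in (0 : ℝ)..1, E (w, s) := by
  refine ⟨intervalIntegral.continuous_parametric_intervalIntegral_of_continuous'
    (f := fun w s => E (w, s)) h.1 _ _, ?_⟩
  obtain ⟨C, N, hC0, hC⟩ := h.exists_nonneg
  -- For `s ∈ (0,1]` one has `1 + ‖(w,s)‖ ≤ 2(1 + ‖w‖)`, whence the factor `2 ^ N`.
  refine ⟨C * 2 ^ N, N, fun w => ?_⟩
  have := intervalIntegral.norm_integral_le_of_norm_le_const (a := (0 : ℝ)) (b := 1)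
    (f := fun s => E (w, s)) (C := C * 2 ^ N * (1 + ‖w‖) ^ N) fun s hs => by
      rw [Set.uIoc_of_le zero_le_one] at hs
      refine (hC _).trans ?_
      rw [mul_assoc, ← mul_pow]
      gcongr
      have h1 : ‖(w, s)‖ ≤ ‖w‖ + 1 := by
        rw [Prod.norm_mk, Real.norm_of_nonneg hs.1.le]
        exact max_le (by linarith) (by linarith [hs.2, norm_nonneg w])
      linarith [norm_nonneg w]
  simpa using this

end Tame

theorem integral_mem_commutant {θ : ℝ} {X : Type*} [MeasurableSpace X] {μ : MeasureTheory.Measure X}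
    {E : X → Op} (hE : ∀ w, E w ∈ commutant θ) : ∫ w, E w ∂μ ∈ commutant θ := by
  by_cases hi : MeasureTheory.Integrable E μ
  · rw [commutant, Subalgebra.mem_centralizer_iff]
    intro g hg
    have e1 := (ContinuousLinearMap.mul ℂ Op g).integral_comp_comm hi
    have e2 := ((ContinuousLinearMap.mul ℂ Op).flip g).integral_comp_comm hi
    simp only [ContinuousLinearMap.mul_apply', ContinuousLinearMap.flip_apply] at e1 e2
    rw [← e1, ← e2]
    congr 1
    ext1 w
    exact (Subalgebra.mem_centralizer_iff ℂ).1 (hE w) g hg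
  -- A non-integrable family has integral 0 by convention, and 0 lies in every centralizer.
  · rw [MeasureTheory.integral_undef hi]
    exact zero_mem _

theorem coeff_integral {X : Type*} [MeasurableSpace X] {μ : MeasureTheory.Measure X}
    {E : X → Op} (hi : MeasureTheory.Integrable E μ) (p : ℤ × ℤ) :
    coeff (∫ w, E w ∂μ) p = ∫ w, coeff (E w) p ∂μ :=
  ((coeffCLM p).integral_comp_comm hi).symm

theorem IsDer.integral {θ : ℝ} {j : Fin 2} {X : Type*} [MeasurableSpace X]
    {μ : MeasureTheory.Measure X} {E E' : X → Op} (h : ∀ w, IsDer θ j (E w) (E' w))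
    (hi : MeasureTheory.Integrable E μ) (hi' : MeasureTheory.Integrable E' μ) :
    IsDer θ j (∫ w, E w ∂μ) (∫ w, E' w ∂μ) where
  left_mem := integral_mem_commutant fun w => (h w).left_mem
  right_mem := integral_mem_commutant fun w => (h w).right_mem
  coeff_eq p := by
    rw [coeff_integral hi, coeff_integral hi', ← MeasureTheory.integral_const_mul]
    congr 1
    ext1 w
    exact (h w).coeff_eq p

/-- Families in the domain of `∇_j^k`, with derivatives of polynomial growth. -/
def Tame (θ : ℝ) (j : Fin 2) {Ω : Type} [NormedAddCommGroup Ω] : ℕ → (Ω → Op) → Prop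
  | 0, E => PolyBdd E ∧ ∀ w, E w ∈ commutant θ
  | k + 1, E => PolyBdd E ∧ ∃ E', (∀ w, IsDer θ j (E w) (E' w)) ∧ Tame θ j k E'

/-! ### Stability of tame families. -/

namespace Tame

variable {θ : ℝ} {j : Fin 2} {Ω Ω' : Type} [NormedAddCommGroup Ω] [NormedAddCommGroup Ω'] {k : ℕ}
  {E F : Ω → Op}

theorem polyBdd (h : Tame θ j k E) : PolyBdd E := by
  cases k <;> exact h.1

theorem mem_commutant (h : Tame θ j k E) (w : Ω) : E w ∈ commutant θ := by
  cases k
  · exact h.2 w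
  · obtain ⟨E', hE', -⟩ := h.2
    exact (hE' w).left_mem

theorem of_succ : ∀ {k : ℕ} {E : Ω → Op}, Tame θ j (k + 1) E → Tame θ j k E
  | 0, _, h => ⟨h.1, h.mem_commutant⟩
  | _ + 1, _, h => by
    obtain ⟨h1, E', h2, h3⟩ := h
    exact ⟨h1, E', h2, of_succ h3⟩

theorem add : ∀ {k : ℕ} {E F : Ω → Op}, Tame θ j k E → Tame θ j k F →
    Tame θ j k fun w => E w + F w
  | 0, _, _, h, h' => ⟨h.1.add h'.1, fun w => add_mem (h.2 w) (h'.2 w)⟩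
  | _ + 1, _, _, h, h' => by
    obtain ⟨h1, E', h2, h3⟩ := h
    obtain ⟨h1', F', h2', h3'⟩ := h'
    exact ⟨h1.add h1', _, fun w => (h2 w).add (h2' w), h3.add h3'⟩

theorem mul : ∀ {k : ℕ} {E F : Ω → Op}, Tame θ j k E → Tame θ j k F →
    Tame θ j k fun w => E w * F w
  | 0, _, _, h, h' => ⟨h.1.mul h'.1, fun w => mul_mem (h.2 w) (h'.2 w)⟩
  | k + 1, _, _, h, h' => by
    have g := h.of_succ
    have g' := h'.of_succ
    obtain ⟨h1, E', h2, h3⟩ := h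
    obtain ⟨h1', F', h2', h3'⟩ := h'
    exact ⟨h1.mul h1', _, fun w => (h2 w).mul (h2' w), (h3.mul g').add (g.mul h3')⟩

theorem smul {c : Ω → ℂ} (hc : PolyBdd c) : ∀ {k : ℕ} {E : Ω → Op}, Tame θ j k E →
    Tame θ j k fun w => c w • E w
  | 0, _, h => ⟨hc.smul h.1, fun w => Subalgebra.smul_mem _ (h.2 w) _⟩
  | _ + 1, _, h => by
    obtain ⟨h1, E', h2, h3⟩ := h
    exact ⟨hc.smul h1, _, fun w => (h2 w).smul (c w), smul hc h3⟩

theorem comp {g : Ω' → Ω} (hg : PolyBdd g) : ∀ {k : ℕ} {E : Ω → Op}, Tame θ j k E →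
    Tame θ j k fun w => E (g w)
  | 0, _, h => ⟨h.1.comp hg, fun w => h.2 _⟩
  | _ + 1, _, h => by
    obtain ⟨h1, E', h2, h3⟩ := h
    exact ⟨h1.comp hg, _, fun w => h2 _, comp hg h3⟩

theorem const : ∀ {k : ℕ} {x : Op}, x ∈ smoothTorus θ → Tame θ j k fun _ : Ω => x
  | 0, x, h => ⟨PolyBdd.const x, fun _ => (mem_smoothTorus_iff.1 h).1⟩
  | _ + 1, x, h => ⟨PolyBdd.const x, _, fun _ => isDer_basicDeriv j h,
      const (basicDeriv_mem j h)⟩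

theorem intervalIntegral : ∀ {k : ℕ} {E : Ω × ℝ → Op}, Tame θ j k E →
    Tame θ j k fun w => ∫ s in (0 : ℝ)..1, E (w, s)
  | 0, E, h => ⟨h.1.intervalIntegral, fun w => by
      beta_reduce
      rw [intervalIntegral.integral_of_le zero_le_one]
      exact integral_mem_commutant fun s => h.2 _⟩
  | _ + 1, E, h => by
    obtain ⟨h1, E', h2, h3⟩ := h
    refine ⟨h1.intervalIntegral, _, fun w => ?_, intervalIntegral h3⟩
    have i1 : IntervalIntegrable (fun s => E (w, s)) MeasureTheory.volume 0 1 :=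
      (h1.1.comp (by fun_prop : Continuous fun s : ℝ => (w, s))).intervalIntegrable _ _
    have i2 : IntervalIntegrable (fun s => E' (w, s)) MeasureTheory.volume 0 1 :=
      (h3.polyBdd.1.comp (by fun_prop : Continuous fun s : ℝ => (w, s))).intervalIntegrable _ _
    beta_reduce
    rw [intervalIntegral.integral_of_le zero_le_one, intervalIntegral.integral_of_le zero_le_one]
    exact IsDer.integral (fun s => h2 (w, s)) i1.1 i2.1

/-- Induction on the order: by Duhamel's formula the derivative of `e^{ith}` is an integral over `s`
of `it` times a product of `∇h` and the same group at the times `(1-s)t` and `st`. Each derivative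
therefore costs only one power of `t`. -/
theorem unitaryGroup {h : Op} (hh : h ∈ smoothTorus θ) (hsa : IsSelfAdjoint h) :
    ∀ {k : ℕ}, Tame θ j k (unitaryGroup h) := by
  have hder : ∀ t, IsDer θ j (NCTorus.unitaryGroup h t)
      (dexp ((I * t) • h) ((I * t) • basicDeriv θ j h)) :=
    fun t => ((isDer_basicDeriv j hh).smul _).exp
  have hpoly : PolyBdd (NCTorus.unitaryGroup h) :=
    ⟨continuous_unitaryGroup h, 1, 0, fun t => by simpa using norm_unitaryGroup_le hsa t⟩
  intro k
  induction k with
  | zero => exact ⟨hpoly, fun t => (hder t).left_mem⟩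
  | succ k ih =>
    refine ⟨hpoly, _, hder, ?_⟩
    simp only [dexp_unitaryGroup]
    have hfst : PolyBdd fun q : ℝ × ℝ => q.1 := PolyBdd.of_clm (ContinuousLinearMap.fst ℝ ℝ ℝ)
    have hsnd : PolyBdd fun q : ℝ × ℝ => q.2 := PolyBdd.of_clm (ContinuousLinearMap.snd ℝ ℝ ℝ)
    have hone : PolyBdd fun q : ℝ × ℝ => 1 - q.2 := by
      simpa [sub_eq_add_neg] using (PolyBdd.const (1 : ℝ)).add
        ((PolyBdd.const (-1 : ℝ)).mul hsnd)
    have hc : PolyBdd fun q : ℝ × ℝ => I * (q.1 : ℂ) :=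
      (PolyBdd.const I).mul (PolyBdd.of_clm
        (Complex.ofRealCLM.comp (ContinuousLinearMap.fst ℝ ℝ ℝ)))
    have e1 := ih.comp (hone.mul hfst)
    have e2 := ih.comp (hsnd.mul hfst)
    exact intervalIntegral (E := fun q : ℝ × ℝ => (I * (q.1 : ℂ)) •
      (NCTorus.unitaryGroup h ((1 - q.2) * q.1) * basicDeriv θ j h *
        NCTorus.unitaryGroup h (q.2 * q.1)))
      (smul hc ((e1.mul (const (basicDeriv_mem j hh))).mul e2))

theorem listProd {n : ℕ} {A : Fin n → Ω → Op} (hA : ∀ i, Tame θ j k (A i)) :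
    Tame θ j k fun w => (List.ofFn fun i => A i w).prod := by
  induction n with
  | zero =>
    have h1 : (1 : Op) ∈ smoothTorus θ := by
      have := monomial_mem_smoothTorus θ 0
      have e : monomial θ 0 = 1 := by
        ext ψ q
        rw [monomial_apply]
        simp
      rwa [e] at this
    simpa using const h1
  | succ n ih =>
    simp only [List.ofFn_succ, List.prod_cons]
    exact (hA 0).mul (ih fun i => hA i.succ)

theorem expWord {h : Op} (hh : h ∈ smoothTorus θ) (hsa : IsSelfAdjoint h) {n : ℕ}
    {ρ : Fin n → Op} (hρ : ∀ i, ρ i ∈ smoothTorus θ) {ξ : Ω → Fin (n + 1) → ℝ}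
    (hξ : ∀ i, PolyBdd fun w => ξ w i) :
    Tame θ j k fun w => expWord h (ξ w) ρ :=
  ((unitaryGroup hh hsa).comp (hξ 0)).mul
    (listProd fun i => (const (hρ i)).mul ((unitaryGroup hh hsa).comp (hξ i.succ)))

theorem exists_coeff_eq : ∀ {k : ℕ} {E : Ω → Op}, Tame θ j k E →
    ∃ E' : Ω → Op, PolyBdd E' ∧
      ∀ w p, coeff (E' w) p = (I * (expo j p : ℂ)) ^ k * coeff (E w) p
  | 0, E, h => ⟨E, h.1, fun w p => by simp⟩
  | k + 1, E, h => by
    obtain ⟨h1, E', h2, h3⟩ := h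
    obtain ⟨E'', h4, h5⟩ := exists_coeff_eq h3
    refine ⟨E'', h4, fun w p => ?_⟩
    rw [h5, (h2 w).coeff_eq, pow_succ, mul_assoc (_ ^ k)]

end Tame

/-- Densities all of whose moments are finite. -/
def HasMoments {Ω : Type} [NormedAddCommGroup Ω] [MeasurableSpace Ω]
    (μ : MeasureTheory.Measure Ω) (c : Ω → ℂ) : Prop :=
  MeasureTheory.AEStronglyMeasurable c μ ∧
    ∀ N : ℕ, MeasureTheory.Integrable (fun w => (1 + ‖w‖) ^ N * ‖c w‖) μ

/-! ### Integration against densities with finite moments. -/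

section Moments

variable {Ω : Type} [NormedAddCommGroup Ω] [MeasurableSpace Ω] [BorelSpace Ω]
  {μ : MeasureTheory.Measure Ω} {c : Ω → ℂ}

theorem HasMoments.smul_polyBdd (hc : HasMoments μ c) {f : Ω → ℂ} (hf : PolyBdd f) :
    HasMoments μ fun w => f w * c w := by
  refine ⟨hf.1.aestronglyMeasurable.mul hc.1, fun N => ?_⟩
  obtain ⟨C, M, hC0, hC⟩ := hf.exists_nonneg
  refine ((hc.2 (N + M)).const_mul C).mono' ?_ (.of_forall fun w => ?_)
  · exact (Continuous.aestronglyMeasurable (by fun_prop)).mul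
      (hf.1.aestronglyMeasurable.mul hc.1).norm
  · rw [Real.norm_of_nonneg (by positivity), norm_mul]
    calc (1 + ‖w‖) ^ N * (‖f w‖ * ‖c w‖) ≤ (1 + ‖w‖) ^ N * (C * (1 + ‖w‖) ^ M * ‖c w‖) := by
          gcongr; exact hC w
      _ = _ := by ring

variable [SecondCountableTopology Ω]

theorem HasMoments.integrable_smul (hc : HasMoments μ c) {F : Type*} [NormedAddCommGroup F]
    [NormedSpace ℂ F] {E : Ω → F} (hE : PolyBdd E) :
    MeasureTheory.Integrable (fun w => c w • E w) μ := by
  obtain ⟨C, N, hC0, hC⟩ := hE.exists_nonneg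
  refine ((hc.2 N).const_mul C).mono' (hc.1.smul hE.1.aestronglyMeasurable)
    (.of_forall fun w => ?_)
  rw [norm_smul]
  calc ‖c w‖ * ‖E w‖ ≤ ‖c w‖ * (C * (1 + ‖w‖) ^ N) := by gcongr; exact hC w
    _ = _ := by ring

theorem HasMoments.integrable (hc : HasMoments μ c) : MeasureTheory.Integrable c μ := by
  simpa using hc.integrable_smul (PolyBdd.const (Ω := Ω) (1 : ℂ))

/-- Iterated derivatives of the family grow polynomially and are integrable against the density.
Their integrals are bounded operators with the coefficients that the smoothness criterion asks for.
-/
theorem integral_mem_smoothTorus {θ : ℝ} (hc : HasMoments μ c) {E : Ω → Op}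
    (hE : ∀ j k, Tame θ j k E) : ∫ w, c w • E w ∂μ ∈ smoothTorus θ := by
  refine mem_smoothTorus_of_forall (integral_mem_commutant fun w =>
    Subalgebra.smul_mem _ ((hE 0 0).mem_commutant w) _) fun j k => ?_
  obtain ⟨E', h1, h2⟩ := (hE j k).exists_coeff_eq
  refine ⟨∫ w, c w • E' w ∂μ, fun p => ?_⟩
  rw [coeff_integral (hc.integrable_smul h1),
    coeff_integral (hc.integrable_smul (hE 0 0).polyBdd), ← MeasureTheory.integral_const_mul]
  congr 1
  ext1 w
  have e : ∀ u : Op, coeff (c w • u) p = c w * coeff u p := map_smul (coeffCLM p) _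
  rw [e, e, h2, mul_left_comm]

end Moments

end NCTorus

namespace NCTorus

open MeasureTheory
open scoped FourierTransform

/-! ### Fourier inversion -/

section Fourier

variable {V : Type} [NormedAddCommGroup V] [InnerProductSpace ℝ V] [FiniteDimensional ℝ V]
  [MeasurableSpace V] [BorelSpace V]

/-- The Fourier transform, normalized such that `g x = ∫ ĝ(ξ) e^{i x·ξ} dξ`. -/
noncomputable def hat (g : 𝓢(V, ℂ)) (ξ : V) : ℂ :=
  ((2 * Real.pi) ^ Module.finrank ℝ V)⁻¹ * ∫ x, Complex.exp (-(I * ⟪x, ξ⟫_ℝ)) * g x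

/-- Passage between two normalizations: `𝓕` carries `2π` in the exponent, which rescales the
frequency. -/
theorem hat_eq (g : 𝓢(V, ℂ)) (ξ : V) :
    hat g ξ = ((2 * Real.pi) ^ Module.finrank ℝ V)⁻¹ * (𝓕 g) ((2 * Real.pi)⁻¹ • ξ) := by
  rw [hat, SchwartzMap.fourier_coe, Real.fourier_eq]
  congr 2
  ext1 x
  rw [Circle.smul_def, Real.fourierChar_apply, smul_eq_mul, inner_smul_right]
  congr 2
  push_cast
  have : (Real.pi : ℂ) ≠ 0 := by exact_mod_cast Real.pi_ne_zero
  field_simp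

theorem continuous_hat (g : 𝓢(V, ℂ)) : Continuous (hat g) := by
  rw [show hat g = _ from funext (hat_eq g)]
  exact continuous_const.mul ((𝓕 g).continuous.comp (by fun_prop))

theorem hasMoments_schwartz (g : 𝓢(V, ℂ)) : HasMoments volume g := by
  refine ⟨g.continuous.aestronglyMeasurable, fun N => ?_⟩
  have h := ((g.integrable_pow_mul volume 0).add (g.integrable_pow_mul volume N)).const_mul
    ((2 : ℝ) ^ (N - 1))
  refine h.mono' (Continuous.aestronglyMeasurable (by fun_prop)) (.of_forall fun x => ?_)
  rw [Real.norm_of_nonneg (by positivity)]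
  have := add_pow_le zero_le_one (norm_nonneg x) N
  calc (1 + ‖x‖) ^ N * ‖g x‖ ≤ 2 ^ (N - 1) * (1 ^ N + ‖x‖ ^ N) * ‖g x‖ := by gcongr
    _ = _ := by simp only [Pi.add_apply, one_pow, pow_zero]; ring

theorem hasMoments_hat (g : 𝓢(V, ℂ)) : HasMoments volume (hat g) := by
  refine ⟨(continuous_hat g).aestronglyMeasurable, fun N => ?_⟩
  have hpi : 1 ≤ 2 * Real.pi := by linarith [Real.pi_gt_three]
  have h := ((((hasMoments_schwartz (𝓕 g)).2 N).comp_smul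
    (inv_ne_zero (by positivity : (2 * Real.pi) ≠ 0))).const_mul
    ((2 * Real.pi) ^ N * ((2 * Real.pi) ^ Module.finrank ℝ V)⁻¹))
  refine h.mono' (Continuous.aestronglyMeasurable (by
    have := continuous_hat g
    fun_prop)) (.of_forall fun x => ?_)
  rw [Real.norm_of_nonneg (by positivity), hat_eq, norm_mul]
  -- Undoing the frequency rescaling costs at most a factor `2π` per moment, because `2π ≥ 1`.
  have h1 : 1 + ‖x‖ ≤ 2 * Real.pi * (1 + ‖(2 * Real.pi)⁻¹ • x‖) := by
    rw [norm_smul, norm_inv, Real.norm_of_nonneg (by positivity : 0 ≤ 2 * Real.pi), mul_add,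
      mul_one, mul_inv_cancel_left₀ (by positivity)]
    gcongr
  rw [Complex.norm_real, Real.norm_of_nonneg (by positivity)]
  calc (1 + ‖x‖) ^ N * (((2 * Real.pi) ^ Module.finrank ℝ V)⁻¹ * ‖(𝓕 g) ((2 * Real.pi)⁻¹ • x)‖)
      ≤ (2 * Real.pi * (1 + ‖(2 * Real.pi)⁻¹ • x‖)) ^ N *
        (((2 * Real.pi) ^ Module.finrank ℝ V)⁻¹ * ‖(𝓕 g) ((2 * Real.pi)⁻¹ • x)‖) := by gcongr
    _ = _ := by rw [mul_pow]; ring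

/-- Fourier inversion after rescaling the frequency; the Jacobian `(2π)^d` cancels the normalizing
constant. -/
theorem integral_hat_mul_exp (g : 𝓢(V, ℂ)) (x : V) :
    ∫ ξ, hat g ξ * Complex.exp (I * ⟪x, ξ⟫_ℝ) = g x := by
  have hpi : (Real.pi : ℂ) ≠ 0 := by exact_mod_cast Real.pi_ne_zero
  have h1 : ∀ ξ, hat g ξ * Complex.exp (I * ⟪x, ξ⟫_ℝ) =
      (((2 * Real.pi) ^ Module.finrank ℝ V)⁻¹ : ℝ) *
        (fun w : V => Complex.exp (2 * Real.pi * ⟪w, x⟫_ℝ * I) * (𝓕 g) w)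
          ((2 * Real.pi)⁻¹ • ξ) := by
    intro ξ
    rw [hat_eq, mul_assoc, mul_comm ((𝓕 g _))]
    beta_reduce
    congr 3
    rw [inner_smul_left, real_inner_comm]
    push_cast
    simp only [map_inv₀, map_mul, conj_trivial]
    push_cast
    field_simp
  rw [integral_congr_ae (.of_forall h1), integral_const_mul]
  refine (congrArg _ (Measure.integral_comp_smul volume
    (fun w : V => Complex.exp (2 * Real.pi * ⟪w, x⟫_ℝ * I) * (𝓕 g) w) (2 * Real.pi)⁻¹)).trans ?_
  have h2 : ∫ w : V, Complex.exp (2 * Real.pi * ⟪w, x⟫_ℝ * I) * (𝓕 g) w = g x := by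
    have h3 := congrArg (fun f : 𝓢(V, ℂ) => f x) (FourierTransform.fourierInv_fourier_eq (F := 𝓢(V, ℂ)) g)
    simp only [SchwartzMap.fourierInv_coe, Real.fourierInv_eq'] at h3
    rw [← h3]
    congr 1
    ext1 w
    rw [smul_eq_mul]
    push_cast
    rfl
  rw [h2, inv_pow, inv_inv, abs_of_pos (by positivity), Complex.real_smul]
  push_cast
  field_simp

end Fourier

theorem fourierHat_eq_hat {n : ℕ} (g : 𝓢(EuclideanSpace ℝ (Fin n), ℂ)) :
    fourierHat g = hat g := by
  ext ξ
  rw [fourierHat, hat, finrank_euclideanSpace_fin]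

theorem exists_cutoff {s U : Set ℝ} (hs : IsCompact s) (hU : IsOpen U) (hsU : s ⊆ U) :
    ∃ χ : ℝ → ℝ, ContDiff ℝ ∞ χ ∧ HasCompactSupport χ ∧ tsupport χ ⊆ U ∧
      ∃ V : Set ℝ, IsOpen V ∧ s ⊆ V ∧ V ⊆ U ∧ ∀ x ∈ V, χ x = 1 := by
  obtain ⟨t, ht, hst, htU⟩ := exists_compact_between hs hU hsU
  obtain ⟨f, hf1, hf0, -⟩ := exists_contMDiffMap_one_nhds_of_subset_interior
    (n := ⊤) (modelWithCornersSelf ℝ ℝ) hs.isClosed hst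
  have hsub : tsupport f ⊆ t :=
    closure_minimal (fun x hx => by_contra fun h => hx (hf0 x h)) ht.isClosed
  obtain ⟨V, hV, hsV, hV1⟩ := mem_nhdsSet_iff_exists.1 hf1
  exact ⟨f, f.contMDiff.contDiff, HasCompactSupport.of_support_subset_isCompact ht
    (subset_closure.trans hsub), hsub.trans htU, V ∩ U, hV.inter hU,
    Set.subset_inter hsV hsU, Set.inter_subset_right, fun x hx => hV1 hx.1⟩

/-- A smooth cutoff function as a Schwartz function. -/
theorem exists_schwartz_cutoff {s U : Set ℝ} (hs : IsCompact s) (hU : IsOpen U) (hsU : s ⊆ U) :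
    ∃ χ : 𝓢(ℝ, ℂ), (∀ x ∉ U, χ x = 0) ∧ ∀ x ∈ s, χ x = 1 := by
  obtain ⟨χ, h1, h2, h3, V, -, h4, -, h5⟩ := exists_cutoff hs hU hsU
  have hc : HasCompactSupport fun x => (χ x : ℂ) := h2.comp_left (g := ((↑) : ℝ → ℂ)) rfl
  have hd : ContDiff ℝ ∞ fun x => (χ x : ℂ) := Complex.ofRealCLM.contDiff.comp h1
  refine ⟨hc.toSchwartzMap hd, fun x hx => ?_, fun x hx => ?_⟩
  · change (χ x : ℂ) = 0
    rw [image_eq_zero_of_notMem_tsupport fun h => hx (h3 h), Complex.ofReal_zero]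
  · change (χ x : ℂ) = 1
    rw [h5 x (h4 hx), Complex.ofReal_one]

/-- Functional calculus in Fourier form. -/
theorem integral_hat_smul_unitaryGroup {h : Op} (hsa : IsSelfAdjoint h) {χ : 𝓢(ℝ, ℂ)}
    (hχ : ∀ x ∈ spectrum ℝ h, χ x = 1) : ∫ t, hat χ t • unitaryGroup h t = 1 := by
  have hn : IsStarNormal h := hsa.isStarNormal
  have hre : ∀ z ∈ spectrum ℂ h, z = (z.re : ℂ) := fun z hz => hsa.mem_spectrum_eq_re hz
  have h1 : ∀ t : ℝ, hat χ t • unitaryGroup h t =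
      cfc (fun z : ℂ => hat χ t * Complex.exp (I * t * z)) h := by
    intro t
    rw [cfc_const_mul _ _ _ (by fun_prop), unitaryGroup,
      ← CFC.complex_exp_eq_normedSpace_exp, cfc_comp_const_mul (I * (t : ℂ)) Complex.exp h]
  simp_rw [h1]
  rw [← cfc_integral (𝕜 := ℂ) (fun t z => hat χ t * Complex.exp (I * t * z))
    (fun t => ‖hat χ t‖) h]
  · rw [← cfc_one ℂ h]
    refine cfc_congr fun z hz => ?_
    have h2 := integral_hat_mul_exp χ z.re
    have h3 : χ z.re = 1 := hχ _ (by
      have := hre z hz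
      rw [this] at hz
      exact (spectrum.algebraMap_mem_iff (S := ℂ) (R := ℝ)).1 hz)
    rw [h3] at h2
    rw [Pi.one_apply, ← h2]
    congr 1
    ext1 t
    congr 2
    rw [hre z hz, mul_assoc]
    simp
  · have := continuous_hat χ
    exact Continuous.continuousOn (by unfold Function.uncurry; fun_prop)
  · refine .of_forall fun t z hz => ?_
    rw [norm_mul, hre z hz, mul_assoc, ← Complex.ofReal_mul, mul_comm I, Complex.norm_exp_ofReal_mul_I,
      mul_one]
  · exact (hasMoments_hat χ).integrable.norm.2

end NCTorus

namespace NCTorus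

open MeasureTheory

/-! ### Independence of the Fourier representation -/

theorem smul_listProd {R A : Type*} [CommSemiring R] [Semiring A] [Algebra R A] {n : ℕ}
    (c : Fin n → R) (x : Fin n → A) :
    (List.ofFn fun i => c i • x i).prod = (∏ i, c i) • (List.ofFn x).prod := by
  induction n with
  | zero => simp
  | succ n ih =>
    simp only [List.ofFn_succ, List.prod_cons, Fin.prod_univ_succ]
    rw [ih, smul_mul_smul_comm]

theorem integral_listProd {A : Type*} [NormedRing A] [NormedAlgebra ℝ A] [CompleteSpace A] {n : ℕ}
    {B : Fin n → ℝ → A} (hB : ∀ i, Integrable (B i)) :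
    Integrable (fun t : Fin n → ℝ => (List.ofFn fun i => B i (t i)).prod) ∧
      ∫ t : Fin n → ℝ, (List.ofFn fun i => B i (t i)).prod =
        (List.ofFn fun i => ∫ s, B i s).prod := by
  induction n with
  | zero => simp [Measure.real, volume_pi]
  | succ n ih =>
    obtain ⟨h1, h2⟩ := ih fun i => hB i.succ
    have hm := (volume_preserving_piFinSuccAbove (fun _ : Fin (n + 1) => ℝ) 0)
    have e : ∀ t : Fin (n + 1) → ℝ, (List.ofFn fun i => B i (t i)).prod =
        (fun z : ℝ × (Fin n → ℝ) => B 0 z.1 * (List.ofFn fun i : Fin n => B i.succ (z.2 i)).prod)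
          (MeasurableEquiv.piFinSuccAbove (fun _ : Fin (n + 1) => ℝ) 0 t) := by
      intro t
      simp [List.ofFn_succ, MeasurableEquiv.piFinSuccAbove]
      rfl
    have hi := (hB 0).mul_prod h1
    constructor
    · simp_rw [e]
      exact (hm.integrable_comp_emb (MeasurableEquiv.measurableEmbedding _)).2 hi
    · simp_rw [e]
      rw [hm.integral_comp (MeasurableEquiv.measurableEmbedding _)
        (fun z : ℝ × (Fin n → ℝ) => B 0 z.1 * (List.ofFn fun i : Fin n => B i.succ (z.2 i)).prod)]
      rw [Measure.volume_eq_prod, integral_prod _ hi, List.ofFn_succ, List.prod_cons, ← h2]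
      have e1 : ∀ x : ℝ, ∫ y : Fin n → ℝ, B 0 x * (List.ofFn fun i : Fin n => B i.succ (y i)).prod =
          B 0 x * ∫ y : Fin n → ℝ, (List.ofFn fun i : Fin n => B i.succ (y i)).prod :=
        fun x => integral_const_mul_of_integrable h1
      simp_rw [e1]
      exact integral_mul_const_of_integrable (hB 0)

theorem continuous_expWord (h : Op) {n : ℕ} (ρ : Fin n → Op) :
    Continuous fun ξ : Fin (n + 1) → ℝ => expWord h ξ ρ := by
  have hl : ∀ {m : ℕ} {A : Fin m → (Fin (n + 1) → ℝ) → Op}, (∀ i, Continuous (A i)) →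
      Continuous fun ξ => (List.ofFn fun i => A i ξ).prod := by
    intro m
    induction m with
    | zero => intro A _; simpa using continuous_const
    | succ m ih =>
      intro A hA
      simp only [List.ofFn_succ, List.prod_cons]
      exact (hA 0).mul (ih fun i => hA i.succ)
  have hu := continuous_unitaryGroup h
  exact (hu.comp (by fun_prop)).mul (hl fun i => continuous_const.mul (hu.comp (by fun_prop)))

theorem exists_norm_expWord_le {h : Op} (hsa : IsSelfAdjoint h) {n : ℕ} (ρ : Fin n → Op) :
    ∃ C, ∀ ξ : Fin (n + 1) → ℝ, ‖expWord h ξ ρ‖ ≤ C := by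
  have hl : ∀ {m : ℕ} {A : Fin m → (Fin (n + 1) → ℝ) → Op}, (∀ i, ∃ C, ∀ ξ, ‖A i ξ‖ ≤ C) →
      ∃ C, ∀ ξ, ‖(List.ofFn fun i => A i ξ).prod‖ ≤ C := by
    intro m
    induction m with
    | zero => exact fun _ => ⟨‖(1 : Op)‖, fun ξ => by simp⟩
    | succ m ih =>
      intro A hA
      obtain ⟨C, hC⟩ := hA 0
      obtain ⟨D, hD⟩ := ih fun i => hA i.succ
      refine ⟨C * D, fun ξ => ?_⟩
      simp only [List.ofFn_succ, List.prod_cons]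
      exact (norm_mul_le _ _).trans (mul_le_mul (hC ξ) (hD ξ) (norm_nonneg _)
        ((norm_nonneg _).trans (hC ξ)))
  obtain ⟨C, hC⟩ := hl (A := fun i ξ => ρ i * unitaryGroup h (ξ i.succ)) fun i =>
    ⟨‖ρ i‖, fun ξ => (norm_mul_le _ _).trans
      (mul_le_of_le_one_right (norm_nonneg _) (norm_unitaryGroup_le hsa _))⟩
  refine ⟨C, fun ξ => ?_⟩
  rw [expWord_eq]
  refine (norm_mul_le _ _).trans ((mul_le_of_le_one_left (norm_nonneg _)
    (norm_unitaryGroup_le hsa _)).trans (hC ξ))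

/-- The integral splits into one integral per exponential, and each one multiplies `e^{iξᵢh}` by
`χ(h) = 1`. Smearing a word with the cutoff therefore does nothing to it. -/
theorem integral_prod_hat_smul_expWord {h : Op} (hsa : IsSelfAdjoint h) {χ : 𝓢(ℝ, ℂ)}
    (hχ : ∀ x ∈ spectrum ℝ h, χ x = 1) {n : ℕ} (ξ : Fin (n + 1) → ℝ) (ρ : Fin n → Op) :
    ∫ t : Fin (n + 1) → ℝ, (∏ i, hat χ (t i)) • expWord h (ξ + t) ρ = expWord h ξ ρ := by
  -- Prepending the factor 1 to `ρ` gives all `n + 1` exponentials the same shape, including the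
  -- leading one.
  let B : Fin (n + 1) → ℝ → Op := fun i s =>
    hat χ s • ((Fin.cons 1 ρ : Fin (n + 1) → Op) i * unitaryGroup h (ξ i + s))
  have hw : ∀ ζ : Fin (n + 1) → ℝ, expWord h ζ ρ =
      (List.ofFn fun i => (Fin.cons 1 ρ : Fin (n + 1) → Op) i * unitaryGroup h (ζ i)).prod := by
    intro ζ
    rw [expWord_eq, List.ofFn_succ, List.prod_cons]
    simp
  have hint : Integrable fun s => hat χ s • unitaryGroup h s :=
    (hasMoments_hat χ).integrable_smul
      ⟨continuous_unitaryGroup h, 1, 0, fun t => by simpa using norm_unitaryGroup_le hsa t⟩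
  have hBe : ∀ i s, B i s = ((Fin.cons 1 ρ : Fin (n + 1) → Op) i * unitaryGroup h (ξ i)) *
      (hat χ s • unitaryGroup h s) := by
    intro i s
    simp only [B]
    rw [unitaryGroup_add, ← mul_assoc, mul_smul_comm]
  have hB : ∀ i, Integrable (B i) := fun i => by
    rw [show B i = _ from funext (hBe i)]
    exact hint.const_mul _
  have hBi : ∀ i, ∫ s, B i s = (Fin.cons 1 ρ : Fin (n + 1) → Op) i * unitaryGroup h (ξ i) := by
    intro i
    simp_rw [hBe i]
    rw [integral_const_mul_of_integrable hint, integral_hat_smul_unitaryGroup hsa hχ, mul_one]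
  have h2 := (integral_listProd hB).2
  rw [hw ξ]
  refine Eq.trans ?_ (h2.trans (congrArg (fun F => (List.ofFn F).prod) (funext hBi)))
  congr 1
  ext1 t
  rw [hw, ← smul_listProd]
  rfl

/-- The Fourier integral of the density `c` along `ξ`. -/
noncomputable def fourierInt {Ω : Type} [MeasurableSpace Ω] (μ : Measure Ω) {n : ℕ} (c : Ω → ℂ)
    (ξ : Ω → Fin n → ℝ) (x : Fin n → ℝ) : ℂ :=
  ∫ w, c w * Complex.exp (I * ((∑ i, x i * ξ w i : ℝ) : ℂ)) ∂μ

/-- `f` is given on `U^n` by the Fourier integral of the density `c` along `ξ`. -/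
def IsFourierRep {Ω : Type} [MeasurableSpace Ω] (μ : Measure Ω) {n : ℕ} (c : Ω → ℂ)
    (ξ : Ω → Fin n → ℝ) (f : (Fin n → ℝ) → ℂ) (U : Set ℝ) : Prop :=
  ∀ x : Fin n → ℝ, (∀ i, x i ∈ U) → f x = fourierInt μ c ξ x

theorem prod_hat_eq (χ : 𝓢(ℝ, ℂ)) {n : ℕ} (ζ : Fin n → ℝ) :
    ∏ i, hat χ (ζ i) = (((2 * Real.pi)⁻¹ : ℝ) : ℂ) ^ n * ∫ x : Fin n → ℝ,
      (∏ i, χ (x i)) * Complex.exp (-(I * ((∑ i, x i * ζ i : ℝ) : ℂ))) := by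
  have e : ∀ x : Fin n → ℝ,
      (∏ i, χ (x i)) * Complex.exp (-(I * ((∑ i, x i * ζ i : ℝ) : ℂ))) =
      ∏ i, (fun s : ℝ => Complex.exp (-(I * ⟪s, ζ i⟫_ℝ)) * χ s) (x i) := by
    intro x
    rw [Finset.prod_mul_distrib, ← Complex.exp_sum, mul_comm]
    congr 2
    push_cast
    rw [Finset.mul_sum, ← Finset.sum_neg_distrib]
    refine Finset.sum_congr rfl fun i _ => ?_
    simp [mul_comm]
  simp_rw [e]
  rw [integral_fintype_prod_volume_eq_prod (fun i (s : ℝ) =>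
    Complex.exp (-(I * ⟪s, ζ i⟫_ℝ)) * χ s)]
  unfold hat
  rw [Finset.prod_mul_distrib]
  simp

theorem continuous_prod_hat (χ : 𝓢(ℝ, ℂ)) (n : ℕ) :
    Continuous fun ζ : Fin n → ℝ => ∏ i, hat χ (ζ i) := by
  have := continuous_hat χ
  fun_prop

theorem integrable_prod_hat (χ : 𝓢(ℝ, ℂ)) (n : ℕ) :
    Integrable fun ζ : Fin n → ℝ => ∏ i, hat χ (ζ i) :=
  Integrable.fintype_prod (f := fun _ : Fin n => hat χ) fun _ => (hasMoments_hat χ).integrable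

/-! ### The density of a function cut off near the spectrum. -/

section Canonical

variable {Ω : Type} [MeasurableSpace Ω] {μ : Measure Ω} [SFinite μ] {c : Ω → ℂ} {n : ℕ}
  {ξ : Ω → Fin n → ℝ}

theorem norm_exp_I_mul (r : ℝ) : ‖Complex.exp (I * (r : ℂ))‖ = 1 := by
  rw [mul_comm, Complex.norm_exp_ofReal_mul_I]

/-- The density of the cut-off function. -/
theorem integral_mul_prod_hat (hc : Integrable c μ) (hξ : Measurable ξ) {f : (Fin n → ℝ) → ℂ}
    {U : Set ℝ} (hf : IsFourierRep μ c ξ f U) {χ : 𝓢(ℝ, ℂ)} (hχ : ∀ x ∉ U, χ x = 0)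
    (ζ : Fin n → ℝ) :
    ∫ w, c w * ∏ i, hat χ (ζ i - ξ w i) ∂μ = (((2 * Real.pi)⁻¹ : ℝ) : ℂ) ^ n *
      ∫ x : Fin n → ℝ, (∏ i, χ (x i)) *
        Complex.exp (-(I * ((∑ i, x i * ζ i : ℝ) : ℂ))) * f x := by
  have hX : Integrable fun x : Fin n → ℝ => ∏ i, χ (x i) :=
    Integrable.fintype_prod (f := fun _ : Fin n => χ) fun _ => χ.integrable
  have e1 : ∀ w, c w * ∏ i, hat χ (ζ i - ξ w i) = (((2 * Real.pi)⁻¹ : ℝ) : ℂ) ^ n *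
      ∫ x : Fin n → ℝ, c w * ((∏ i, χ (x i)) *
        Complex.exp (-(I * ((∑ i, x i * (ζ i - ξ w i) : ℝ) : ℂ)))) := by
    intro w
    rw [prod_hat_eq, integral_const_mul]
    ring
  simp_rw [e1]
  rw [integral_const_mul]
  congr 1
  have hi : Integrable (fun z : Ω × (Fin n → ℝ) => c z.1 * ((∏ i, χ (z.2 i)) *
      Complex.exp (-(I * ((∑ i, z.2 i * (ζ i - ξ z.1 i) : ℝ) : ℂ))))) (μ.prod volume) := by
    have h1 := hc.mul_prod hX
    have h2 := h1.mul_bdd (g := fun z : Ω × (Fin n → ℝ) =>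
      Complex.exp (-(I * ((∑ i, z.2 i * (ζ i - ξ z.1 i) : ℝ) : ℂ)))) (c := 1)
      (by
        refine Measurable.aestronglyMeasurable ?_
        have : ∀ i, Measurable fun z : Ω × (Fin n → ℝ) => ξ z.1 i := fun i =>
          ((measurable_pi_apply i).comp hξ).comp measurable_fst
        fun_prop)
      (.of_forall fun z => by
        have := norm_exp_I_mul (-∑ i, z.2 i * (ζ i - ξ z.1 i))
        rw [Complex.ofReal_neg, mul_neg] at this
        exact this.le)
    simpa only [mul_assoc] using h2
  rw [integral_integral_swap hi]
  congr 1
  ext1 x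
  -- Inside `U^n` the inner integral reassembles `f`; outside, some cutoff factor vanishes, so the
  -- behaviour of the density there is irrelevant.
  by_cases hx : ∀ i, x i ∈ U
  · rw [hf x hx, fourierInt, ← integral_const_mul]
    congr 1
    ext1 w
    have : Complex.exp (-(I * ((∑ i, x i * (ζ i - ξ w i) : ℝ) : ℂ))) =
        Complex.exp (-(I * ((∑ i, x i * ζ i : ℝ) : ℂ))) *
          Complex.exp (I * ((∑ i, x i * ξ w i : ℝ) : ℂ)) := by
      rw [← Complex.exp_add]
      congr 1
      simp_rw [mul_sub, Finset.sum_sub_distrib]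
      push_cast
      ring
    rw [this]
    ring
  · push Not at hx
    obtain ⟨i, hi⟩ := hx
    have : ∏ i, χ (x i) = 0 := Finset.prod_eq_zero (Finset.mem_univ i) (hχ _ hi)
    simp [this]

end Canonical

/-- The integral of `e^{iξ₀h} ρ₁ ⋯ ρₙ e^{iξₙh}` against a density only depends on the Fourier
integral of the density near the spectrum of `h`. -/
theorem integral_smul_expWord_eq {Ω : Type} [MeasurableSpace Ω] {μ : Measure Ω} [SFinite μ]
    {c : Ω → ℂ} {n : ℕ} {ξ : Ω → Fin (n + 1) → ℝ} (hc : Integrable c μ) (hξ : Measurable ξ)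
    {f : (Fin (n + 1) → ℝ) → ℂ} {U : Set ℝ} (hf : IsFourierRep μ c ξ f U)
    {h : Op} (hsa : IsSelfAdjoint h) {χ : 𝓢(ℝ, ℂ)} (hχU : ∀ x ∉ U, χ x = 0)
    (hχ : ∀ x ∈ spectrum ℝ h, χ x = 1) (ρ : Fin n → Op) :
    ∫ w, c w • expWord h (ξ w) ρ ∂μ = ∫ ζ : Fin (n + 1) → ℝ,
      ((((2 * Real.pi)⁻¹ : ℝ) : ℂ) ^ (n + 1) * ∫ x : Fin (n + 1) → ℝ, (∏ i, χ (x i)) *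
        Complex.exp (-(I * ((∑ i, x i * ζ i : ℝ) : ℂ))) * f x) • expWord h ζ ρ := by
  obtain ⟨C, hC⟩ := exists_norm_expWord_le hsa ρ
  -- The word is smeared and the integration variable translated, so that `w` enters only through
  -- the scalar weight. Fubini then lets the `w`-integral be carried out first.
  have e1 : ∀ w, c w • expWord h (ξ w) ρ = ∫ ζ : Fin (n + 1) → ℝ,
      (c w * ∏ i, hat χ (ζ i - ξ w i)) • expWord h ζ ρ := by
    intro w
    rw [← integral_prod_hat_smul_expWord hsa hχ, ← integral_smul,
      ← integral_add_right_eq_self (μ := (volume : Measure (Fin (n + 1) → ℝ)))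
        (fun ζ : Fin (n + 1) → ℝ => (c w * ∏ i, hat χ (ζ i - ξ w i)) • expWord h ζ ρ) (ξ w)]
    congr 1
    ext1 t
    rw [smul_smul, add_comm t]
    simp
  have hi : Integrable (fun z : Ω × (Fin (n + 1) → ℝ) => c z.1 * ∏ i, hat χ (z.2 i - ξ z.1 i))
      (μ.prod volume) := by
    have hm : AEStronglyMeasurable
        (fun z : Ω × (Fin (n + 1) → ℝ) => c z.1 * ∏ i, hat χ (z.2 i - ξ z.1 i))
        (μ.prod volume) := by
      refine hc.1.comp_fst.mul (Measurable.aestronglyMeasurable ?_)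
      exact (continuous_prod_hat χ (n + 1)).measurable.comp
        (measurable_snd.sub (hξ.comp measurable_fst))
    refine (integrable_prod_iff hm).2 ⟨.of_forall fun w => ?_, ?_⟩
    · exact ((integrable_prod_hat χ (n + 1)).comp_sub_right (ξ w)).const_mul (c w)
    · have e2 : ∀ w, ∫ ζ : Fin (n + 1) → ℝ, ‖c w * ∏ i, hat χ (ζ i - ξ w i)‖ =
          ‖c w‖ * ∫ ζ : Fin (n + 1) → ℝ, ‖∏ i, hat χ (ζ i)‖ := by
        intro w
        simp_rw [norm_mul (c w)]
        rw [integral_const_mul]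
        congr 1
        exact integral_sub_right_eq_self (μ := (volume : Measure (Fin (n + 1) → ℝ)))
          (fun ζ : Fin (n + 1) → ℝ => ‖∏ i, hat χ (ζ i)‖) (ξ w)
      simp_rw [e2]
      exact hc.norm.mul_const _
  have hi2 : Integrable (fun z : Ω × (Fin (n + 1) → ℝ) =>
      (c z.1 * ∏ i, hat χ (z.2 i - ξ z.1 i)) • expWord h z.2 ρ) (μ.prod volume) := by
    refine (hi.norm.mul_const C).mono'
      (hi.1.smul (continuous_expWord h ρ).aestronglyMeasurable.comp_snd) (.of_forall fun z => ?_)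
    rw [norm_smul]
    gcongr
    exact hC _
  simp_rw [e1]
  rw [integral_integral_swap hi2]
  congr 1
  ext1 ζ
  rw [integral_smul_const, integral_mul_prod_hat hc hξ hf hχU]

/-- A test extension represents the function it extends. -/
theorem IsTestExtension.isFourierRep {n : ℕ} {g : 𝓢(EuclideanSpace ℝ (Fin n), ℂ)}
    {f : (Fin n → ℝ) → ℂ} {U : Set ℝ}
    (hg : ∀ x : Fin n → ℝ, (∀ j, x j ∈ U) → g (WithLp.toLp 2 x) = f x) :
    IsFourierRep volume (hat g) (fun w i => w i) f U := by
  intro x hx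
  rw [← hg x hx, ← integral_hat_mul_exp, fourierInt]
  congr 1
  ext1 w
  congr 4
  simp [PiLp.inner_apply, mul_comm]

/-- The rearrangement operator may be computed from any Fourier representation. -/
theorem rearr_eq {Ω : Type} [MeasurableSpace Ω] {μ : Measure Ω} [SFinite μ]
    {c : Ω → ℂ} {n : ℕ} {ξ : Ω → Fin (n + 1) → ℝ} (hc : Integrable c μ) (hξ : Measurable ξ)
    {f : (Fin (n + 1) → ℝ) → ℂ} {U : Set ℝ} (hf : IsFourierRep μ c ξ f U)
    {h : Op} (hsa : IsSelfAdjoint h) (hU : IsOpen U) (hhU : spectrum ℝ h ⊆ U)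
    (H : ∃ g, IsTestExtension h f g) (ρ : Fin n → Op) :
    rearr h f ρ = ∫ w, c w • expWord h (ξ w) ρ ∂μ := by
  rw [rearr, dif_pos H]
  set g := H.choose
  obtain ⟨-, V, hV, hhV, hgV⟩ := H.choose_spec
  -- One cutoff supported in both neighbourhoods reduces the chosen extension and the given
  -- representation to the same expression in `f`.
  obtain ⟨χ, hχ0, hχ1⟩ := exists_schwartz_cutoff (spectrum.isCompact h) (hU.inter hV)
    (Set.subset_inter hhU hhV)
  rw [integral_smul_expWord_eq hc hξ hf hsa (fun x hx => hχ0 x fun h => hx h.1) hχ1]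
  rw [fourierHat_eq_hat, ← integral_smul_expWord_eq (hasMoments_hat g).integrable
    (by fun_prop) (IsTestExtension.isFourierRep hgV) hsa (fun x hx => hχ0 x fun h => hx h.2) hχ1]

end NCTorus

namespace NCTorus

open MeasureTheory
open scoped FourierTransform Topology

/-! ### Spectral functions -/

theorem exists_testExtension {n : ℕ} {h : Op} {f : (Fin (n + 1) → ℝ) → ℂ} (hf : f ∈ CSpec n h) :
    ∃ g, IsTestExtension h f g := by
  obtain ⟨U, hU, hhU, hfU⟩ := hf
  obtain ⟨χ, h1, h2, h3, V, hV, hhV, hVU, h5⟩ := exists_cutoff (spectrum.isCompact h) hU hhU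
  let G : EuclideanSpace ℝ (Fin (n + 1)) → ℂ := fun x => (∏ i, (χ (x i) : ℂ)) * f fun i => x i
  have hzero : ∀ x : EuclideanSpace ℝ (Fin (n + 1)), ∀ i, x i ∉ tsupport χ → G x = 0 := by
    intro x i hi
    have : ∏ i, (χ (x i) : ℂ) = 0 := Finset.prod_eq_zero (Finset.mem_univ i) (by
      rw [image_eq_zero_of_notMem_tsupport hi, Complex.ofReal_zero])
    simp [G, this]
  have hcont : ∀ i, Continuous fun x : EuclideanSpace ℝ (Fin (n + 1)) => x i := fun i => by
    fun_prop
  have hof : ContDiff ℝ ∞ fun x : EuclideanSpace ℝ (Fin (n + 1)) => (fun i => x i) :=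
    contDiff_pi.2 fun i => contDiff_euclidean.1 contDiff_id i
  have hd : ContDiff ℝ ∞ G := by
    rw [contDiff_iff_contDiffAt]
    intro x
    by_cases hx : ∀ i, x i ∈ U
    · have e1 : ContDiffAt ℝ ∞ (fun x : EuclideanSpace ℝ (Fin (n + 1)) => f fun i => x i) x := by
        refine ContDiffAt.comp x (hfU.contDiffAt ?_) hof.contDiffAt
        exact (isOpen_set_pi Set.finite_univ fun _ _ => hU).mem_nhds fun i _ => hx i
      refine ContDiffAt.mul ?_ e1
      refine ContDiff.contDiffAt (contDiff_prod fun i _ => ?_)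
      exact Complex.ofRealCLM.contDiff.comp (h1.comp (contDiff_euclidean.1 contDiff_id i))
    · push Not at hx
      obtain ⟨i, hi⟩ := hx
      have : G =ᶠ[𝓝 x] fun _ => 0 := by
        have ho : IsOpen {y : EuclideanSpace ℝ (Fin (n + 1)) | y i ∉ tsupport χ} :=
          (isClosed_tsupport χ).isOpen_compl.preimage (hcont i)
        filter_upwards [ho.mem_nhds (fun h => hi (h3 h))] with y hy
        exact hzero y i hy
      exact contDiffAt_const.congr_of_eventuallyEq this
  have hc : HasCompactSupport G := by
    have hK : IsCompact (WithLp.toLp 2 ''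
        (Set.univ.pi fun _ : Fin (n + 1) => tsupport χ) :
          Set (EuclideanSpace ℝ (Fin (n + 1)))) :=
      (isCompact_univ_pi fun _ => h2).image (PiLp.continuous_toLp 2 _)
    refine HasCompactSupport.intro hK fun x hx => ?_
    by_contra hne
    refine hx ⟨fun i => x i, fun i _ => ?_, rfl⟩
    by_contra hi
    exact hne (hzero x i hi)
  refine ⟨hc.toSchwartzMap hd, hc, V, hV, hhV, fun x hx => ?_⟩
  change (∏ i, (χ (x i) : ℂ)) * f x = f x
  rw [Finset.prod_eq_one fun i _ => by rw [h5 _ (hx i), Complex.ofReal_one], one_mul]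

theorem add_smul_mem_CSpec {n : ℕ} {h : Op} {f f' : (Fin (n + 1) → ℝ) → ℂ} (hf : f ∈ CSpec n h)
    (hf' : f' ∈ CSpec n h) (z : ℂ) : f + z • f' ∈ CSpec n h := by
  obtain ⟨U, hU, hhU, hfU⟩ := hf
  obtain ⟨V, hV, hhV, hfV⟩ := hf'
  refine ⟨U ∩ V, hU.inter hV, Set.subset_inter hhU hhV, ?_⟩
  exact (hfU.mono (Set.pi_mono fun _ _ => Set.inter_subset_left)).add
    (contDiffOn_const.smul (hfV.mono (Set.pi_mono fun _ _ => Set.inter_subset_right)))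

/-- The chosen extensions need not add up, so linearity is not automatic. It holds because the
combined densities represent the combined function, and any representation may be used. -/
theorem rearr_add_smul {n : ℕ} {h : Op} (hsa : IsSelfAdjoint h) {f f' : (Fin (n + 1) → ℝ) → ℂ}
    (hf : f ∈ CSpec n h) (hf' : f' ∈ CSpec n h) (z : ℂ) (ρ : Fin n → Op) :
    rearr h (f + z • f') ρ = rearr h f ρ + z • rearr h f' ρ := by
  obtain ⟨g, -, U, hU, hhU, hg⟩ := exists_testExtension hf
  obtain ⟨g', -, V, hV, hhV, hg'⟩ := exists_testExtension hf'
  have i1 := (hasMoments_hat g).integrable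
  have i2 := (hasMoments_hat g').integrable
  have hm : Measurable fun (w : EuclideanSpace ℝ (Fin (n + 1))) i => w i := by fun_prop
  have r1 := IsTestExtension.isFourierRep hg
  have r2 := IsTestExtension.isFourierRep hg'
  have r3 : IsFourierRep volume (hat g + z • hat g') (fun w i => w i) (f + z • f') (U ∩ V) := by
    intro x hx
    have hb : ∀ c : EuclideanSpace ℝ (Fin (n + 1)) → ℂ, Integrable c →
        Integrable fun w => c w * Complex.exp (I * ((∑ i, x i * w i : ℝ) : ℂ)) := fun c hc =>
      hc.mul_bdd (c := 1) (Continuous.aestronglyMeasurable (by fun_prop))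
        (.of_forall fun w => (norm_exp_I_mul _).le)
    have j2 : Integrable fun w => z • (hat g' w * Complex.exp (I * ((∑ i, x i * w i : ℝ) : ℂ))) :=
      (hb _ i2).smul z
    rw [Pi.add_apply, Pi.smul_apply, r1 x fun i => (hx i).1, r2 x fun i => (hx i).2, fourierInt,
      fourierInt, fourierInt, ← integral_smul, ← integral_add (hb _ i1) j2]
    congr 1
    ext1 w
    simp only [Pi.add_apply, Pi.smul_apply, smul_eq_mul]
    ring
  obtain ⟨C, hC⟩ := exists_norm_expWord_le hsa ρ
  have hb : ∀ c : EuclideanSpace ℝ (Fin (n + 1)) → ℂ, Integrable c →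
      Integrable fun w => c w • expWord h (fun i => w i) ρ := fun c hc => by
    refine (hc.norm.mul_const C).mono' (hc.1.smul (Continuous.aestronglyMeasurable
      ((continuous_expWord h ρ).comp (by fun_prop)))) (.of_forall fun z => ?_)
    rw [norm_smul]
    gcongr
    exact hC _
  have j2 : Integrable fun w => z • hat g' w • expWord h (fun i => w i) ρ := (hb _ i2).smul z
  rw [rearr_eq i1 hm r1 hsa hU hhU (exists_testExtension hf),
    rearr_eq i2 hm r2 hsa hV hhV (exists_testExtension hf'),
    rearr_eq (i1.add (i2.smul z)) hm r3 hsa (hU.inter hV) (Set.subset_inter hhU hhV)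
      (exists_testExtension (add_smul_mem_CSpec hf hf' z)), ← integral_smul,
    ← integral_add (hb _ i1) j2]
  congr 1
  ext1 w
  simp only [Pi.add_apply, Pi.smul_apply, add_smul, smul_assoc]

/-! ### Smoothness of Fourier integrals. -/

section Smooth

variable {Ω : Type} [NormedAddCommGroup Ω] [NormedSpace ℝ Ω] [MeasurableSpace Ω] [BorelSpace Ω]
  [SecondCountableTopology Ω] {μ : Measure Ω} {c : Ω → ℂ} {n : ℕ} {ξ : Ω → Fin n → ℝ}

/-- Fourier integrals of densities with moments are smooth. -/
theorem contDiff_fourierInt (hc : HasMoments μ c) (hcc : Continuous c)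
    (hξ : PolyBdd ξ) : ContDiff ℝ ∞ (fourierInt μ c ξ) := by
  -- Pushing the measure forward along the graph of `ξ` makes the phase bilinear in the integration
  -- variable and `x`, while the second component still carries the density.
  let e : Ω → (Fin n → ℝ) × Ω := fun w => (ξ w, w)
  have he : Continuous e := hξ.1.prodMk continuous_id
  have hep : PolyBdd e := by
    refine ⟨he, ?_⟩
    obtain ⟨C, N, hC0, hC⟩ := hξ.exists_nonneg
    refine ⟨C + 1, N + 1, fun w => ?_⟩
    have h1 : 1 ≤ 1 + ‖w‖ := by linarith [norm_nonneg w]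
    have h2 : (1 + ‖w‖) ^ N ≤ (1 + ‖w‖) ^ (N + 1) := pow_le_pow_right₀ h1 (by omega)
    have h3 : 1 + ‖w‖ ≤ (1 + ‖w‖) ^ (N + 1) := le_self_pow₀ h1 (by omega)
    refine max_le ?_ ?_
    · refine (hC w).trans ?_
      have : 0 ≤ (1 + ‖w‖) ^ (N + 1) := by positivity
      nlinarith
    · change ‖w‖ ≤ _
      have : 0 ≤ (1 + ‖w‖) ^ (N + 1) := by positivity
      nlinarith
  -- The factor `-(2π)⁻¹` compensates the character `e^{-2πi·}` used by `VectorFourier`.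
  let L : (Fin n → ℝ) × Ω →L[ℝ] (Fin n → ℝ) →L[ℝ] ℝ := -((2 * Real.pi)⁻¹ : ℝ) • ∑ i,
    ((ContinuousLinearMap.proj (R := ℝ) (φ := fun _ : Fin n => ℝ) i).comp
      (ContinuousLinearMap.fst ℝ (Fin n → ℝ) Ω)).smulRight
      (ContinuousLinearMap.proj (R := ℝ) (φ := fun _ : Fin n => ℝ) i)
  have key := VectorFourier.contDiff_fourierIntegral (N := ⊤) (μ := μ.map e) L
    (f := fun v : (Fin n → ℝ) × Ω => c v.2) (fun k _ => by
      rw [integrable_map_measure (Continuous.aestronglyMeasurable (by fun_prop))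
        he.measurable.aemeasurable]
      have hk : PolyBdd fun w => ((‖e w‖ ^ k : ℝ) : ℂ) := by
        refine PolyBdd.comp (E := fun v : (Fin n → ℝ) × Ω => ((‖v‖ ^ k : ℝ) : ℂ)) ⟨by fun_prop, 1, k, fun v => ?_⟩
          hep
        rw [Complex.norm_real, norm_pow, norm_norm, one_mul]
        gcongr
        linarith
      refine (hc.integrable_smul hk).norm.congr (.of_forall fun w => ?_)
      simp only [Function.comp_apply, norm_smul, Complex.norm_real, norm_pow, norm_norm]
      rw [mul_comm])
  refine (congrArg (ContDiff ℝ ∞) (funext fun x => ?_)).mpr key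
  rw [VectorFourier.fourierIntegral, integral_map he.measurable.aemeasurable
    (Continuous.aestronglyMeasurable (by
      have : Continuous fun v : (Fin n → ℝ) × Ω => -(L v x) := by fun_prop
      exact (Real.continuous_fourierChar.comp this).smul (hcc.comp continuous_snd))), fourierInt]
  congr 1
  ext1 w
  rw [Circle.smul_def, Real.fourierChar_apply, smul_eq_mul, mul_comm]
  congr 2
  simp only [L, e, ContinuousLinearMap.toLinearMap₁₂_apply]
  simp
  have : (Real.pi : ℂ) ≠ 0 := by exact_mod_cast Real.pi_ne_zero
  field_simp
  simp [mul_comm]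

theorem IsFourierRep.mem_CSpec {ξ : Ω → Fin (n + 1) → ℝ} (hc : HasMoments μ c) (hcc : Continuous c)
    (hξ : PolyBdd ξ) {f : (Fin (n + 1) → ℝ) → ℂ} {U : Set ℝ} (hf : IsFourierRep μ c ξ f U)
    {h : Op} (hU : IsOpen U) (hhU : spectrum ℝ h ⊆ U) : f ∈ CSpec n h :=
  ⟨U, hU, hhU, ((contDiff_fourierInt hc hcc hξ).contDiffOn).congr fun x hx =>
    hf x fun i => hx i (Set.mem_univ i)⟩

end Smooth

/-! ### Faces of Fourier integrals -/

theorem IsFourierRep.cyc {Ω : Type} [MeasurableSpace Ω] {μ : Measure Ω} {n : ℕ} {c : Ω → ℂ}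
    {ξ : Ω → Fin (n + 1) → ℝ} {f : (Fin (n + 1) → ℝ) → ℂ} {U : Set ℝ}
    (hf : IsFourierRep μ c ξ f U) :
    IsFourierRep μ c (fun w i => ξ w (i + 1)) (cyc f) U := by
  intro x hx
  rw [NCTorus.cyc, hf _ fun i => hx _, fourierInt, fourierInt]
  congr 1
  ext1 w
  congr 4
  exact Fintype.sum_equiv (Equiv.subRight 1) _ _ fun i => by simp

/-- Any factor `D` continuous at `a` is the divided difference: off the diagonal by division, on it
as the limit of slopes. The confluent value then needs no separate computation. -/
theorem dslope_eq_of_forall {Φ D : ℝ → ℂ} {U : Set ℝ} (hU : IsOpen U) {a b : ℝ} (ha : a ∈ U)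
    (hb : b ∈ U) (h : ∀ z ∈ U, Φ z - Φ a = (z - a) * D z) (hD : ContinuousAt D a) :
    dslope Φ a b = D b := by
  by_cases hab : b = a
  · subst hab
    rw [dslope_same]
    refine HasDerivAt.deriv ?_
    rw [hasDerivAt_iff_tendsto_slope]
    refine (hD.tendsto.mono_left nhdsWithin_le_nhds).congr' ?_
    filter_upwards [self_mem_nhdsWithin, mem_nhdsWithin_of_mem_nhds (hU.mem_nhds ha)] with z hz hzU
    have hz : z - b ≠ 0 := sub_ne_zero.2 hz
    rw [slope_def_module, h z hzU, Complex.real_smul, ← mul_assoc, Complex.ofReal_inv,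
      Complex.ofReal_sub, inv_mul_cancel₀ (by exact_mod_cast hz), one_mul]
  · have hz : b - a ≠ 0 := sub_ne_zero.2 hab
    rw [dslope_of_ne _ hab, slope_def_module, h b hb, Complex.real_smul, ← mul_assoc,
      Complex.ofReal_inv, Complex.ofReal_sub, inv_mul_cancel₀ (by exact_mod_cast hz), one_mul]

/-- The fundamental theorem of calculus along the segment from `a` to `b`, the scalar counterpart of
Duhamel's formula. -/
theorem exp_sub_exp_eq_integral (r a b t : ℝ) :
    Complex.exp (I * ((b * t + r : ℝ) : ℂ)) - Complex.exp (I * ((a * t + r : ℝ) : ℂ)) =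
      (b - a) * ∫ s in Set.Ioc (0 : ℝ) 1,
        I * t * Complex.exp (I * ((((1 - s) * a + s * b) * t + r : ℝ) : ℂ)) := by
  rw [← integral_const_mul, ← intervalIntegral.integral_of_le zero_le_one]
  rw [intervalIntegral.integral_eq_sub_of_hasDerivAt
    (f := fun s : ℝ => Complex.exp (I * ((((1 - s) * a + s * b) * t + r : ℝ) : ℂ)))]
  · simp
  · intro s _
    have h1 : HasDerivAt (fun s : ℝ => (((1 - s) * a + s * b) * t + r : ℝ)) ((b - a) * t) s := by
      have := ((((hasDerivAt_id s).const_sub 1).mul_const a).add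
        ((hasDerivAt_id s).mul_const b)).mul_const t |>.add_const r
      refine this.congr_deriv ?_
      ring
    have h2 := (h1.ofReal_comp.const_mul I).cexp
    refine h2.congr_deriv ?_
    push_cast
    ring
  · exact Continuous.intervalIntegrable (by fun_prop) _ _

end NCTorus

namespace NCTorus

open MeasureTheory
open scoped FourierTransform Topology

/-- The added parameter stays in `(0,1]`, so it enlarges `1 + ‖w‖` by at most a factor 2. -/
theorem HasMoments.comp_fst {Ω : Type} [NormedAddCommGroup Ω] [MeasurableSpace Ω] [BorelSpace Ω]
    [SecondCountableTopology Ω] {μ : Measure Ω} [SFinite μ] {c : Ω → ℂ} (hc : HasMoments μ c) :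
    HasMoments (μ.prod (volume.restrict (Set.Ioc (0 : ℝ) 1))) fun z => c z.1 := by
  refine ⟨hc.1.comp_fst, fun N => ?_⟩
  have h1 := ((hc.2 N).comp_fst (volume.restrict (Set.Ioc (0 : ℝ) 1))).const_mul (2 ^ N)
  have hae : ∀ᵐ z ∂μ.prod (volume.restrict (Set.Ioc (0 : ℝ) 1)), z.2 ∈ Set.Ioc (0 : ℝ) 1 :=
    Measure.quasiMeasurePreserving_snd.ae (ae_restrict_mem measurableSet_Ioc)
  refine h1.mono' ((Continuous.aestronglyMeasurable (by fun_prop)).mul hc.1.comp_fst.norm) ?_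
  filter_upwards [hae] with z hz
  rw [Real.norm_of_nonneg (by positivity), ← mul_assoc, ← mul_pow]
  gcongr
  have : ‖z‖ ≤ ‖z.1‖ + 1 := by
    rw [Prod.norm_def, Real.norm_of_nonneg hz.1.le]
    exact max_le (by linarith) (by linarith [hz.2, norm_nonneg z.1])
  linarith [norm_nonneg z.1]

/-- The directions in the Fourier integral of a divided difference. -/
def faceDir {Ω : Type} {n : ℕ} (j : Fin (n + 1)) (ξ : Ω → Fin (n + 1) → ℝ) (z : Ω × ℝ) :
    Fin (n + 2) → ℝ :=
  j.succ.insertNth (z.2 * ξ z.1 j) (Function.update (ξ z.1) j ((1 - z.2) * ξ z.1 j))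

theorem sum_mul_update {n : ℕ} (j : Fin n) (x ξ : Fin n → ℝ) (t : ℝ) :
    ∑ i, x i * Function.update ξ j t i = x j * t + ∑ i ∈ Finset.univ.erase j, x i * ξ i := by
  rw [← Finset.add_sum_erase _ _ (Finset.mem_univ j), Function.update_self]
  congr 1
  refine Finset.sum_congr rfl fun i hi => ?_
  rw [Function.update_of_ne (Finset.ne_of_mem_erase hi)]

theorem sum_faceDir {Ω : Type} {n : ℕ} (j : Fin (n + 1)) (ξ : Ω → Fin (n + 1) → ℝ) (z : Ω × ℝ)
    (x : Fin (n + 2) → ℝ) :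
    ∑ i, x i * faceDir j ξ z i = ((1 - z.2) * x j.castSucc + z.2 * x j.succ) * ξ z.1 j +
      ∑ i ∈ Finset.univ.erase j, x (j.succ.succAbove i) * ξ z.1 i := by
  rw [Fin.sum_univ_succAbove _ j.succ]
  simp only [faceDir, Fin.insertNth_apply_same, Fin.insertNth_apply_succAbove]
  rw [sum_mul_update j fun i => x (j.succ.succAbove i), Fin.succAbove_of_castSucc_lt _ _ Fin.castSucc_lt_succ]
  ring

theorem PolyBdd.pi {Ω : Type} [NormedAddCommGroup Ω] {n : ℕ} {f : Ω → Fin n → ℝ}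
    (h : ∀ i, PolyBdd fun w => f w i) : PolyBdd f := by
  refine ⟨continuous_pi fun i => (h i).1, ?_⟩
  choose C N hC0 hC using fun i => (h i).exists_nonneg
  refine ⟨∑ i, C i, ∑ i, N i, fun w => ?_⟩
  have h1 : 1 ≤ 1 + ‖w‖ := by linarith [norm_nonneg w]
  refine (pi_norm_le_iff_of_nonneg (mul_nonneg (Finset.sum_nonneg fun i _ => hC0 i)
    (by positivity))).2 fun i => (hC i w).trans ?_
  gcongr
  · exact Finset.sum_nonneg fun i _ => hC0 i
  · exact Finset.single_le_sum (fun i _ => hC0 i) (Finset.mem_univ i)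
  · exact Finset.single_le_sum (fun i _ => Nat.zero_le (N i)) (Finset.mem_univ i)

theorem PolyBdd.apply {Ω : Type} [NormedAddCommGroup Ω] {n : ℕ} {f : Ω → Fin n → ℝ}
    (h : PolyBdd f) (i : Fin n) : PolyBdd fun w => f w i :=
  (PolyBdd.of_clm (ContinuousLinearMap.proj (R := ℝ) (φ := fun _ : Fin n => ℝ) i)).comp h

theorem PolyBdd.ofReal {Ω : Type} [NormedAddCommGroup Ω] {f : Ω → ℝ} (h : PolyBdd f) :
    PolyBdd fun w => (f w : ℂ) :=
  (PolyBdd.of_clm Complex.ofRealCLM).comp h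

theorem polyBdd_faceDir {Ω : Type} [NormedAddCommGroup Ω] [NormedSpace ℝ Ω] {n : ℕ}
    {ξ : Ω → Fin (n + 1) → ℝ} (j : Fin (n + 1)) (hξ : PolyBdd ξ) :
    PolyBdd (faceDir j ξ) := by
  have h1 : PolyBdd fun z : Ω × ℝ => z.1 := PolyBdd.of_clm (ContinuousLinearMap.fst ℝ Ω ℝ)
  have h2 : PolyBdd fun z : Ω × ℝ => z.2 := PolyBdd.of_clm (ContinuousLinearMap.snd ℝ Ω ℝ)
  have h3 : PolyBdd fun z : Ω × ℝ => 1 - z.2 := by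
    simpa [sub_eq_add_neg] using (PolyBdd.const (1 : ℝ)).add
      ((PolyBdd.const (-1 : ℝ)).mul h2)
  refine PolyBdd.pi fun i => ?_
  refine Fin.succAboveCases j.succ ?_ (fun l => ?_) i
  · simp only [faceDir, Fin.insertNth_apply_same]
    exact h2.mul ((hξ.apply j).comp h1)
  · simp only [faceDir, Fin.insertNth_apply_succAbove]
    by_cases hl : l = j
    · subst hl
      simp only [Function.update_self]
      exact h3.mul ((hξ.apply l).comp h1)
    · simp only [Function.update_of_ne hl]
      exact (hξ.apply l).comp h1

theorem continuous_face {Ω : Type} [NormedAddCommGroup Ω] {c : Ω → ℂ} {n : ℕ}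
    {ξ : Ω → Fin (n + 1) → ℝ} (hcc : Continuous c) (hξ : PolyBdd ξ) (j : Fin (n + 1)) :
    Continuous fun z : Ω × ℝ => I * (ξ z.1 j : ℂ) * c z.1 := by
  have := hξ.1
  fun_prop

section Face

variable {Ω : Type} [NormedAddCommGroup Ω] [NormedSpace ℝ Ω] [MeasurableSpace Ω] [BorelSpace Ω]
  [SecondCountableTopology Ω] {μ : Measure Ω} [SFinite μ] {c : Ω → ℂ} {n : ℕ}
  {ξ : Ω → Fin (n + 1) → ℝ}

theorem hasMoments_face (hc : HasMoments μ c) (hξ : PolyBdd ξ) (j : Fin (n + 1)) :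
    HasMoments (μ.prod (volume.restrict (Set.Ioc (0 : ℝ) 1)))
      fun z => I * (ξ z.1 j : ℂ) * c z.1 :=
  hc.comp_fst.smul_polyBdd (f := fun z : Ω × ℝ => I * (ξ z.1 j : ℂ))
    ((PolyBdd.const I).mul ((hξ.apply j).ofReal.comp
      (PolyBdd.of_clm (ContinuousLinearMap.fst ℝ Ω ℝ))))

/-- Divided differences of Fourier integrals are Fourier integrals. -/
theorem IsFourierRep.face (hc : HasMoments μ c) (hcc : Continuous c) (hξ : PolyBdd ξ)
    {f : (Fin (n + 1) → ℝ) → ℂ} {U : Set ℝ} (hU : IsOpen U) (hf : IsFourierRep μ c ξ f U)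
    (j : Fin (n + 1)) :
    IsFourierRep (μ.prod (volume.restrict (Set.Ioc (0 : ℝ) 1)))
      (fun z => I * (ξ z.1 j : ℂ) * c z.1) (faceDir j ξ) (face j f) U := by
  intro x hx
  set μ' := μ.prod (volume.restrict (Set.Ioc (0 : ℝ) 1))
  set c' : Ω × ℝ → ℂ := fun z => I * (ξ z.1 j : ℂ) * c z.1 with hc'
  have hm := hasMoments_face hc hξ j
  have hp := polyBdd_faceDir j hξ
  have hD : Continuous fun t : ℝ =>
      fourierInt μ' c' (faceDir j ξ) (Function.update x j.succ t) :=
    (contDiff_fourierInt hm (continuous_face hcc hξ j) hp).continuous.comp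
      (continuous_const.update j.succ continuous_id)
  -- All arguments except the node at `j.succ` are frozen; the candidate quotient is a smooth
  -- Fourier integral, hence continuous in that node.
  have key := dslope_eq_of_forall hU (hx j.castSucc) (hx j.succ)
    (Φ := fun z : ℝ => f (Function.update (fun l => x (j.succ.succAbove l)) j z))
    (D := fun t : ℝ => fourierInt μ' c' (faceDir j ξ) (Function.update x j.succ t)) ?_
    hD.continuousAt
  · rw [NCTorus.face, key, Function.update_eq_self]
  intro t ht
  have hval : ∀ s ∈ U, f (Function.update (fun l => x (j.succ.succAbove l)) j s) =
      ∫ w, c w * Complex.exp (I * ((s * ξ w j +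
        ∑ i ∈ Finset.univ.erase j, x (j.succ.succAbove i) * ξ w i : ℝ) : ℂ)) ∂μ := by
    intro s hs
    rw [hf _ fun i => ?_, fourierInt]
    · congr 1
      ext1 w
      congr 4
      simp_rw [mul_comm _ (ξ w _)]
      rw [sum_mul_update j]
    · by_cases hi : i = j
      · subst hi; rwa [Function.update_self]
      · rw [Function.update_of_ne hi]; exact hx _
  have hb : ∀ s : ℝ, Integrable (fun w => c w * Complex.exp (I * ((s * ξ w j +
        ∑ i ∈ Finset.univ.erase j, x (j.succ.succAbove i) * ξ w i : ℝ) : ℂ))) μ := fun s =>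
    hc.integrable.mul_bdd (c := 1) (Continuous.aestronglyMeasurable (by
      have := hξ.1
      fun_prop)) (.of_forall fun w => (norm_exp_I_mul _).le)
  rw [hval t ht, hval _ (hx j.castSucc), ← integral_sub (hb _) (hb _), fourierInt]
  have hi : Integrable (fun z : Ω × ℝ => c' z * Complex.exp (I *
      ((∑ i, Function.update x j.succ t i * faceDir j ξ z i : ℝ) : ℂ))) μ' :=
    hm.integrable.mul_bdd (c := 1) (Continuous.aestronglyMeasurable (by
      have := hp.1
      fun_prop)) (.of_forall fun w => (norm_exp_I_mul _).le)
  rw [integral_prod _ hi, ← integral_const_mul]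
  congr 1
  ext1 w
  rw [← mul_sub, exp_sub_exp_eq_integral, mul_left_comm, ← integral_const_mul]
  congr 2
  ext1 s
  rw [sum_faceDir]
  have e1 : ∑ i ∈ Finset.univ.erase j,
      Function.update x j.succ t (j.succ.succAbove i) * ξ w i =
      ∑ i ∈ Finset.univ.erase j, x (j.succ.succAbove i) * ξ w i :=
    Finset.sum_congr rfl fun i _ => by
      rw [Function.update_of_ne (Fin.succAbove_ne _ _)]
  rw [Function.update_self, Function.update_of_ne (Fin.castSucc_lt_succ).ne]
  dsimp only [hc']
  rw [e1]
  ring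

end Face

/-! ### The symmetrized density -/

/-- The plane of Fourier variables. -/
abbrev Plane : Type := EuclideanSpace ℝ (Fin 2)

/-- The coordinates of the plane. -/
def coords (w : Plane) (i : Fin 2) : ℝ := w i

theorem polyBdd_coords : PolyBdd coords :=
  PolyBdd.pi fun i => PolyBdd.of_clm (EuclideanSpace.proj (𝕜 := ℝ) i)

/-- The exchange of the two Fourier variables. -/
noncomputable def flip : Plane ≃ₗᵢ[ℝ] Plane :=
  LinearIsometryEquiv.piLpCongrLeft 2 ℝ ℝ (Equiv.swap 0 1)

theorem flip_apply (w : Plane) (i : Fin 2) : flip w i = w (i + 1) := by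
  rw [flip, LinearIsometryEquiv.piLpCongrLeft_apply]
  fin_cases i <;> simp [Equiv.piCongrLeft'_apply]

theorem flip_flip (w : Plane) : flip (flip w) = w := by
  ext i
  rw [flip_apply, flip_apply]
  fin_cases i <;> rfl

theorem integral_comp_flip {F : Type*} [NormedAddCommGroup F] [NormedSpace ℝ F] (f : Plane → F) :
    ∫ w, f (flip w) = ∫ w, f w :=
  flip.measurePreserving.integral_comp flip.toHomeomorph.measurableEmbedding f

theorem HasMoments.comp_flip {c : Plane → ℂ} (hc : HasMoments volume c) :
    HasMoments volume fun w => c (flip w) := by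
  refine ⟨hc.1.comp_measurePreserving flip.measurePreserving, fun N => ?_⟩
  have := (flip.measurePreserving.integrable_comp_emb flip.toHomeomorph.measurableEmbedding).2
    (hc.2 N)
  refine this.congr (.of_forall fun w => ?_)
  simp

theorem HasMoments.neg_add {Ω : Type} [NormedAddCommGroup Ω] [MeasurableSpace Ω] [BorelSpace Ω]
    {μ : Measure Ω} {c c' : Ω → ℂ} (hc : HasMoments μ c)
    (hc' : HasMoments μ c') : HasMoments μ fun w => -(c w + c' w) := by
  refine ⟨(hc.1.add hc'.1).neg, fun N => ?_⟩
  refine ((hc.2 N).add (hc'.2 N)).mono' ((Continuous.aestronglyMeasurable (by fun_prop)).mul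
    (hc.1.add hc'.1).neg.norm) (.of_forall fun w => ?_)
  rw [Real.norm_of_nonneg (by positivity), norm_neg, Pi.add_apply, ← mul_add]
  gcongr
  exact norm_add_le _ _

/-- Swapping the two arguments of `T` amounts to swapping the Fourier variables, and this exchange
preserves the measure. -/
theorem IsFourierRep.symmetrize {b : Plane → ℂ} (hb : Integrable b) {T : (Fin 2 → ℝ) → ℂ}
    {U : Set ℝ} (hT : IsFourierRep volume b coords T U) :
    IsFourierRep volume (fun w => -(b w + b (flip w))) coords (-(T + NCTorus.cyc T)) U := by
  intro x hx
  have hb' : Integrable fun w => b (flip w) :=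
    (flip.measurePreserving.integrable_comp_emb flip.toHomeomorph.measurableEmbedding).2 hb
  have h2 : NCTorus.cyc T x = fourierInt volume (fun w => b (flip w)) coords x := by
    rw [hT.cyc x hx, fourierInt, fourierInt, ← integral_comp_flip]
    congr 1
  have hi : ∀ c : Plane → ℂ, Integrable c →
      Integrable fun w => c w * Complex.exp (I * ((∑ i, x i * coords w i : ℝ) : ℂ)) := fun c hc =>
    hc.mul_bdd (c := 1) (Continuous.aestronglyMeasurable (by
      have := polyBdd_coords.1
      fun_prop)) (.of_forall fun w => (norm_exp_I_mul _).le)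
  rw [Pi.neg_apply, Pi.add_apply, hT x hx, h2, fourierInt, fourierInt, fourierInt,
    ← integral_add (hi _ hb) (hi _ hb'), ← integral_neg]
  congr 1
  ext1 w
  ring

end NCTorus

namespace NCTorus

open MeasureTheory
open scoped FourierTransform Topology

/-! ### The derivative of the unitary group -/

/-- The derivative of `e^{ith}` in the direction `x`. -/
noncomputable def groupDeriv (h x : Op) (t : ℝ) : Op := dexp ((I * t) • h) ((I * t) • x)

theorem groupDeriv_eq (h x : Op) (t : ℝ) : groupDeriv h x t =
    ∫ s in (0 : ℝ)..1, (I * t) • (unitaryGroup h ((1 - s) * t) * x * unitaryGroup h (s * t)) :=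
  dexp_unitaryGroup h x t

theorem hasDerivAt_unitaryGroup (h a : Op) (t ε : ℝ) :
    HasDerivAt (fun ε : ℝ => unitaryGroup (h + ε • a) t) (groupDeriv (h + ε • a) a t) ε := by
  have key := hasDerivAt_exp_add_smul ((I * t) • h) ((I * t) • a) ε
  have e : ∀ r : ℝ, (I * t) • h + r • (I * t) • a = (I * t) • (h + r • a) := fun r => by
    rw [smul_add, smul_comm]
  refine (key.congr_deriv ?_).congr_of_eventuallyEq (.of_forall fun r => ?_)
  · exact congrArg (fun X => dexp X ((I * t) • a)) (e ε)
  · exact congrArg NormedSpace.exp (e r).symm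

theorem isDer_unitaryGroup {θ : ℝ} {j : Fin 2} {h h' : Op} (hd : IsDer θ j h h') (t : ℝ) :
    IsDer θ j (unitaryGroup h t) (groupDeriv h h' t) :=
  (hd.smul _).exp

theorem polyBdd_unitaryGroup {h : Op} (hsa : IsSelfAdjoint h) : PolyBdd (unitaryGroup h) :=
  ⟨continuous_unitaryGroup h, 1, 0, fun t => by simpa using norm_unitaryGroup_le hsa t⟩

theorem polyBdd_fst {Ω : Type} [NormedAddCommGroup Ω] [NormedSpace ℝ Ω] :
    PolyBdd fun z : Ω × ℝ => z.1 := PolyBdd.of_clm (ContinuousLinearMap.fst ℝ Ω ℝ)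

theorem polyBdd_snd {Ω : Type} [NormedAddCommGroup Ω] [NormedSpace ℝ Ω] :
    PolyBdd fun z : Ω × ℝ => z.2 := PolyBdd.of_clm (ContinuousLinearMap.snd ℝ Ω ℝ)

theorem polyBdd_one_sub_snd {Ω : Type} [NormedAddCommGroup Ω] [NormedSpace ℝ Ω] :
    PolyBdd fun z : Ω × ℝ => 1 - z.2 := by
  simpa [sub_eq_add_neg] using (PolyBdd.const (1 : ℝ)).add
    ((PolyBdd.const (-1 : ℝ)).mul (polyBdd_snd (Ω := Ω)))

theorem polyBdd_groupDeriv {h : Op} (hsa : IsSelfAdjoint h) (x : Op) :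
    PolyBdd (groupDeriv h x) := by
  rw [show groupDeriv h x = _ from funext (groupDeriv_eq h x)]
  have hu := polyBdd_unitaryGroup hsa
  exact PolyBdd.intervalIntegral (E := fun z : ℝ × ℝ => (I * (z.1 : ℂ)) •
    (unitaryGroup h ((1 - z.2) * z.1) * x * unitaryGroup h (z.2 * z.1)))
    (((PolyBdd.const I).mul polyBdd_fst.ofReal).smul
      (((hu.comp (polyBdd_one_sub_snd.mul polyBdd_fst)).mul (PolyBdd.const x)).mul
        (hu.comp (polyBdd_snd.mul polyBdd_fst))))

theorem norm_groupDeriv_le {h : Op} (hsa : IsSelfAdjoint h) (x : Op) (t : ℝ) :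
    ‖groupDeriv h x t‖ ≤ |t| * ‖x‖ := by
  rw [groupDeriv_eq]
  have := intervalIntegral.norm_integral_le_of_norm_le_const (a := (0 : ℝ)) (b := 1)
    (f := fun s => (I * (t : ℂ)) • (unitaryGroup h ((1 - s) * t) * x * unitaryGroup h (s * t)))
    (C := |t| * ‖x‖) fun s _ => by
      rw [norm_smul, norm_mul, Complex.norm_I, one_mul, Complex.norm_real, Real.norm_eq_abs]
      gcongr
      refine (norm_mul_le _ _).trans ((mul_le_of_le_one_right (norm_nonneg _)
        (norm_unitaryGroup_le hsa _)).trans ?_)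
      exact (norm_mul_le _ _).trans (mul_le_of_le_one_left (norm_nonneg _)
        (norm_unitaryGroup_le hsa _))
  simpa using this

theorem isSelfAdjoint_add_smul {h a : Op} (hsa : IsSelfAdjoint h) (ha : IsSelfAdjoint a) (t : ℝ) :
    IsSelfAdjoint (h + t • a) := by
  refine hsa.add ?_
  rw [real_smul_eq, isSelfAdjoint_iff, star_smul, ha.star_eq, Complex.star_def,
    Complex.conj_ofReal]

/-! ### Trace identities -/

theorem trace_add (x y : Op) : trace (x + y) = trace x + trace y := map_add (coeffCLM 0) x y

theorem trace_smul (z : ℂ) (x : Op) : trace (z • x) = z * trace x := map_smul (coeffCLM 0) z x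

theorem norm_trace_le (x : Op) : ‖trace x‖ ≤ ‖x‖ := norm_coeff_le x 0

theorem polyBdd_trace {Ω : Type} [NormedAddCommGroup Ω] {E : Ω → Op} (hE : PolyBdd E) :
    PolyBdd fun w => trace (E w) := by
  refine ⟨(coeffCLM 0).continuous.comp hE.1, ?_⟩
  obtain ⟨-, C, N, hC⟩ := hE
  exact ⟨C, N, fun w => (norm_trace_le _).trans (hC w)⟩

theorem trace_integral_mul {X : Type*} [MeasurableSpace X] {μ : Measure X} {E : X → Op}
    (hE : Integrable E μ) (a : Op) :
    trace ((∫ w, E w ∂μ) * a) = ∫ w, trace (E w * a) ∂μ := by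
  rw [← integral_mul_const_of_integrable hE]
  exact coeff_integral (hE.mul_const a) 0

/-- Cyclicity brings `a` to the end, and the two halves of the split exponential come to enclose
`y`. This is the source of the last face. -/
theorem trace_groupDeriv_mul {θ : ℝ} {h a y : Op} (hsa : IsSelfAdjoint h) (hh : h ∈ smoothTorus θ)
    (ha : a ∈ commutant θ) (hy : y ∈ commutant θ) (t : ℝ) :
    trace (groupDeriv h a t * y) = trace ((∫ s in (0 : ℝ)..1,
      (I * t) • (unitaryGroup h (s * t) * y * unitaryGroup h ((1 - s) * t))) * a) := by
  have hu : ∀ t, unitaryGroup h t ∈ commutant θ := fun t =>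
    (Tame.unitaryGroup (j := 0) (k := 0) hh hsa).mem_commutant t
  have hc := continuous_unitaryGroup h
  rw [groupDeriv_eq, intervalIntegral.integral_of_le zero_le_one,
    intervalIntegral.integral_of_le zero_le_one, trace_integral_mul, trace_integral_mul]
  · congr 1
    ext1 s
    rw [smul_mul_assoc, smul_mul_assoc, trace_smul, trace_smul, mul_assoc _ _ y,
      trace_mul_comm (mul_mem (hu _) ha) (mul_mem (hu _) hy), ← mul_assoc (_ * y), mul_assoc _ _ a]
  · exact (Continuous.intervalIntegrable (by fun_prop) _ _).1
  · exact (Continuous.intervalIntegrable (by fun_prop) _ _).1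

/-- The integral over the parameter of a divided difference. -/
theorem integral_face {c : Plane → ℂ} (hc : HasMoments volume c) (i : Fin 2)
    {X : Plane × ℝ → Op} (hX : PolyBdd X) :
    ∫ z, (I * (coords z.1 i : ℂ) * c z.1) • X z
        ∂((volume : Measure Plane).prod (volume.restrict (Set.Ioc (0 : ℝ) 1))) =
      ∫ w, c w • ∫ s in (0 : ℝ)..1, (I * (coords w i : ℂ)) • X (w, s) := by
  have hi := (hasMoments_face hc polyBdd_coords i).integrable_smul hX
  rw [integral_prod _ hi]
  congr 1
  ext1 w
  rw [intervalIntegral.integral_of_le zero_le_one, ← integral_smul]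
  congr 1
  ext1 s
  rw [smul_smul, mul_comm (c w)]

/-! ### The first variation of the quadratic functional -/

section Variation

variable {h h' a a' : Op}

/-- The quadratic form at Fourier variables `w`. -/
noncomputable def word (h h' : Op) (w : Plane) : Op :=
  unitaryGroup h (w 0) * h' * unitaryGroup h (w 1) * h'

/-- The derivative of `word` in the direction `(a, a')`. -/
noncomputable def wordDeriv (h h' a a' : Op) (w : Plane) : Op :=
  groupDeriv h a (w 0) * h' * unitaryGroup h (w 1) * h' +
    unitaryGroup h (w 0) * a' * unitaryGroup h (w 1) * h' +
    unitaryGroup h (w 0) * h' * groupDeriv h a (w 1) * h' +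
    unitaryGroup h (w 0) * h' * unitaryGroup h (w 1) * a'

theorem hasDerivAt_word (h h' a a' : Op) (w : Plane) (ε : ℝ) :
    HasDerivAt (fun ε : ℝ => word (h + ε • a) (h' + ε • a') w)
      (wordDeriv (h + ε • a) (h' + ε • a') a a' w) ε := by
  have h0 := hasDerivAt_unitaryGroup h a (w 0) ε
  have h1 := hasDerivAt_unitaryGroup h a (w 1) ε
  have h2 : HasDerivAt (fun ε : ℝ => h' + ε • a') a' ε := by
    simpa using ((hasDerivAt_id ε).smul_const a').const_add h'
  refine (((h0.mul h2).mul h1).mul h2).congr_deriv ?_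
  simp only [wordDeriv, Pi.mul_apply, add_mul]

theorem polyBdd_apply (i : Fin 2) : PolyBdd fun w : Plane => w i := polyBdd_coords.apply i

theorem polyBdd_word (hsa : IsSelfAdjoint h) (h' : Op) : PolyBdd (word h h') :=
  ((((polyBdd_unitaryGroup hsa).comp (polyBdd_apply 0)).mul (PolyBdd.const h')).mul
    ((polyBdd_unitaryGroup hsa).comp (polyBdd_apply 1))).mul (PolyBdd.const h')

theorem polyBdd_wordDeriv (hsa : IsSelfAdjoint h) (h' a a' : Op) :
    PolyBdd (wordDeriv h h' a a') := by
  have u := fun i : Fin 2 => (polyBdd_unitaryGroup hsa).comp (polyBdd_apply i)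
  have d := fun i : Fin 2 => (polyBdd_groupDeriv hsa a).comp (polyBdd_apply i)
  have k := fun x : Op => PolyBdd.const (Ω := Plane) x
  exact (((((d 0).mul (k h')).mul (u 1)).mul (k h')).add
    ((((u 0).mul (k a')).mul (u 1)).mul (k h'))).add
    ((((u 0).mul (k h')).mul (d 1)).mul (k h')) |>.add
    ((((u 0).mul (k h')).mul (u 1)).mul (k a'))

theorem norm_wordDeriv_le (hsa : IsSelfAdjoint h) (w : Plane) :
    ‖wordDeriv h h' a a' w‖ ≤ 2 * (‖w‖ * ‖a‖ * ‖h'‖ * ‖h'‖ + ‖a'‖ * ‖h'‖) := by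
  have hu : ∀ i, ‖unitaryGroup h (w i)‖ ≤ 1 := fun i => norm_unitaryGroup_le hsa _
  have hd : ∀ i, ‖groupDeriv h a (w i)‖ ≤ ‖w‖ * ‖a‖ := fun i =>
    (norm_groupDeriv_le hsa a _).trans (by
      gcongr
      exact PiLp.norm_apply_le w i)
  have hm : ∀ {x₁ x₂ x₃ x₄ : Op} {r₁ r₂ r₃ r₄ : ℝ}, ‖x₁‖ ≤ r₁ → ‖x₂‖ ≤ r₂ → ‖x₃‖ ≤ r₃ →
      ‖x₄‖ ≤ r₄ → ‖x₁ * x₂ * x₃ * x₄‖ ≤ r₁ * r₂ * r₃ * r₄ := by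
    intro x₁ x₂ x₃ x₄ r₁ r₂ r₃ r₄ k₁ k₂ k₃ k₄
    have p₁ := (norm_nonneg _).trans k₁
    have p₂ := (norm_nonneg _).trans k₂
    have p₃ := (norm_nonneg _).trans k₃
    exact (norm_mul_le _ _).trans (mul_le_mul ((norm_mul_le _ _).trans (mul_le_mul
      ((norm_mul_le _ _).trans (mul_le_mul k₁ k₂ (norm_nonneg _) p₁)) k₃ (norm_nonneg _)
      (mul_nonneg p₁ p₂))) k₄ (norm_nonneg _) (mul_nonneg (mul_nonneg p₁ p₂) p₃))
  have b1 := hm (hd 0) le_rfl (hu 1) (le_refl ‖h'‖) (x₂ := h')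
  have b2 := hm (hu 0) le_rfl (hu 1) (le_refl ‖h'‖) (x₂ := a')
  have b3 := hm (hu 0) le_rfl (hd 1) (le_refl ‖h'‖) (x₂ := h')
  have b4 := hm (hu 0) le_rfl (hu 1) (le_refl ‖a'‖) (x₂ := h')
  rw [wordDeriv]
  refine (norm_add_le _ _).trans ((add_le_add ((norm_add_le _ _).trans (add_le_add
    ((norm_add_le _ _).trans (add_le_add b1 b2)) b3)) b4).trans (le_of_eq ?_))
  ring

/-- Differentiation under the Fourier integral. -/
theorem hasDerivAt_integral_word {b : Plane → ℂ} (hb : HasMoments volume b)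
    (hsa : IsSelfAdjoint h) (hasa : IsSelfAdjoint a) (h' a' : Op) :
    HasDerivAt (fun ε : ℝ => ∫ w, b w * trace (word (h + ε • a) (h' + ε • a') w))
      (∫ w, b w * trace (wordDeriv h h' a a' w)) 0 := by
  -- `M` bounds `‖h' + ε • a'‖` for all `|ε| < 1`, which makes the dominating function independent
  -- of `ε`.
  set M := ‖h'‖ + ‖a'‖ with hM
  have hsa' := fun ε : ℝ => isSelfAdjoint_add_smul hsa hasa ε
  have key := hasDerivAt_integral_of_dominated_loc_of_deriv_le
    (μ := (volume : Measure Plane)) (x₀ := (0 : ℝ)) (s := Metric.ball 0 1)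
    (F := fun ε w => b w * trace (word (h + ε • a) (h' + ε • a') w))
    (F' := fun ε w => b w * trace (wordDeriv (h + ε • a) (h' + ε • a') a a' w))
    (bound := fun w => ‖b w‖ * (2 * (‖w‖ * ‖a‖ * M * M + ‖a'‖ * M)))
    (Metric.ball_mem_nhds 0 one_pos)
    (.of_forall fun ε => (hb.integrable_smul (polyBdd_trace (polyBdd_word (hsa' ε) _))).1)
    (hb.integrable_smul (polyBdd_trace (polyBdd_word (hsa' 0) _)))
    (hb.integrable_smul (polyBdd_trace (polyBdd_wordDeriv (hsa' 0) _ _ _))).1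
    (.of_forall fun w ε hε => by
      rw [norm_mul]
      gcongr
      refine (norm_trace_le _).trans ((norm_wordDeriv_le (hsa' ε) w).trans ?_)
      have h1 : ‖h' + ε • a'‖ ≤ M := by
        refine (norm_add_le _ _).trans ?_
        rw [norm_smul, hM]
        gcongr
        have : ‖ε‖ < 1 := by simpa using hε
        exact mul_le_of_le_one_left (norm_nonneg _) this.le
      gcongr)
    (by
      have hp : PolyBdd fun w : Plane => (2 * (‖w‖ * ‖a‖ * M * M + ‖a'‖ * M) : ℂ) := by
        have hn : PolyBdd fun w : Plane => ‖w‖ := ⟨continuous_norm, 1, 1, fun w => by simp⟩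
        have k := fun x : ℂ => PolyBdd.const (Ω := Plane) x
        exact (k 2).mul ((((hn.ofReal.mul (k ‖a‖)).mul (k M)).mul (k M)).add (k (‖a'‖ * M)))
      refine (hb.integrable_smul hp).norm.congr (.of_forall fun w => ?_)
      beta_reduce
      rw [norm_smul]
      congr 1
      have : (2 * (‖w‖ * ‖a‖ * M * M + ‖a'‖ * M) : ℂ) =
          ((2 * (‖w‖ * ‖a‖ * M * M + ‖a'‖ * M) : ℝ) : ℂ) := by push_cast; rfl
      rw [this, Complex.norm_real, Real.norm_of_nonneg (by positivity)])
    (.of_forall fun w ε _ => by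
      have h1 := hasDerivAt_word h h' a a' w ε
      have h2 := ((coeffCLM 0).restrictScalars ℝ).hasFDerivAt.comp_hasDerivAt ε h1
      exact h2.const_mul (b w))
  have := key.2
  simpa only [zero_smul, add_zero] using this

end Variation

end NCTorus

namespace NCTorus

open MeasureTheory
open scoped FourierTransform Topology

/-! ### Fourier densities of spectral functions of two variables -/

/-- `c` is a Fourier density of `K` near the spectrum of `h`. -/
structure IsDensity (h : Op) (c : Plane → ℂ) (K : (Fin 2 → ℝ) → ℂ) : Prop where
  moments : HasMoments volume c
  continuous : Continuous c
  exists_rep : ∃ U : Set ℝ, IsOpen U ∧ spectrum ℝ h ⊆ U ∧ IsFourierRep volume c coords K U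

theorem exists_isDensity {h : Op} {T : (Fin 2 → ℝ) → ℂ} (hT : T ∈ CSpec 1 h) :
    ∃ b, IsDensity h b T := by
  obtain ⟨g, -, U, hU, hhU, hg⟩ := exists_testExtension hT
  exact ⟨hat g, hasMoments_hat g, continuous_hat g, U, hU, hhU,
    IsTestExtension.isFourierRep hg⟩

theorem integral_smul_trace {c : Plane → ℂ} (hc : HasMoments volume c) {X : Plane → Op}
    (hX : PolyBdd X) (a : Op) : trace ((∫ w, c w • X w) * a) = ∫ w, c w * trace (X w * a) := by
  rw [trace_integral_mul (hc.integrable_smul hX)]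
  simp_rw [smul_mul_assoc, trace_smul]

theorem polyBdd_expWord {Ω : Type} [NormedAddCommGroup Ω] {h : Op} (hsa : IsSelfAdjoint h) {n : ℕ}
    {ξ : Ω → Fin (n + 1) → ℝ} (hξ : PolyBdd ξ) (ρ : Fin n → Op) :
    PolyBdd fun z => expWord h (ξ z) ρ := by
  obtain ⟨C, hC⟩ := exists_norm_expWord_le hsa ρ
  exact ⟨(continuous_expWord h ρ).comp hξ.1, C, 0, fun z => by simpa using hC (ξ z)⟩

theorem groupDeriv_mul (h x y : Op) (t : ℝ) : groupDeriv h x t * y = ∫ s in (0 : ℝ)..1,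
    (I * t) • (unitaryGroup h ((1 - s) * t) * x * unitaryGroup h (s * t) * y) := by
  have hu := continuous_unitaryGroup h
  rw [groupDeriv_eq]
  simpa only [ContinuousLinearMap.flip_apply, ContinuousLinearMap.mul_apply', smul_mul_assoc] using
    (((ContinuousLinearMap.mul ℂ Op).flip y).intervalIntegral_comp_comm
      (Continuous.intervalIntegrable (μ := volume) (a := 0) (b := 1)
        (u := fun s : ℝ => (I * (t : ℂ)) •
          (unitaryGroup h ((1 - s) * t) * x * unitaryGroup h (s * t))) (by fun_prop))).symm

theorem mul_groupDeriv (h x y : Op) (t : ℝ) : y * groupDeriv h x t = ∫ s in (0 : ℝ)..1,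
    (I * t) • (y * (unitaryGroup h ((1 - s) * t) * x * unitaryGroup h (s * t))) := by
  have hu := continuous_unitaryGroup h
  rw [groupDeriv_eq]
  simpa only [ContinuousLinearMap.mul_apply', mul_smul_comm] using
    ((ContinuousLinearMap.mul ℂ Op y).intervalIntegral_comp_comm
      (Continuous.intervalIntegrable (μ := volume) (a := 0) (b := 1)
        (u := fun s : ℝ => (I * (t : ℂ)) •
          (unitaryGroup h ((1 - s) * t) * x * unitaryGroup h (s * t))) (by fun_prop))).symm

namespace IsDensity

variable {h : Op} {c b : Plane → ℂ} {K T : (Fin 2 → ℝ) → ℂ}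

theorem symmetrize (hb : IsDensity h b T) :
    IsDensity h (fun w => -(b w + b (flip w))) (-(T + NCTorus.cyc T)) := by
  obtain ⟨U, hU, hhU, hr⟩ := hb.exists_rep
  exact ⟨hb.moments.neg_add hb.moments.comp_flip,
    (hb.continuous.add (hb.continuous.comp flip.continuous)).neg, U, hU, hhU,
    hr.symmetrize hb.moments.integrable⟩

theorem mem_CSpec (hc : IsDensity h c K) : K ∈ CSpec 1 h := by
  obtain ⟨U, hU, hhU, hr⟩ := hc.exists_rep
  exact hr.mem_CSpec hc.moments hc.continuous polyBdd_coords hU hhU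

theorem face_mem_CSpec (hc : IsDensity h c K) (i : Fin 2) : face i K ∈ CSpec 2 h := by
  obtain ⟨U, hU, hhU, hr⟩ := hc.exists_rep
  exact (hr.face hc.moments hc.continuous polyBdd_coords hU i).mem_CSpec
    (hasMoments_face hc.moments polyBdd_coords i)
    (continuous_face hc.continuous polyBdd_coords i) (polyBdd_faceDir i polyBdd_coords) hU hhU

theorem lastFace_mem_CSpec (hc : IsDensity h c K) : lastFace K ∈ CSpec 2 h := by
  obtain ⟨U, hU, hhU, hr⟩ := hc.exists_rep
  exact (hr.face hc.moments hc.continuous polyBdd_coords hU 0).cyc.mem_CSpec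
    (hasMoments_face hc.moments polyBdd_coords 0)
    (continuous_face hc.continuous polyBdd_coords 0)
    (PolyBdd.pi fun i => (polyBdd_faceDir 0 polyBdd_coords).apply (i + 1)) hU hhU

/-- By upper hemicontinuity the spectrum of a small perturbation stays in the same open set, so a
fixed density can be used throughout the differentiation. -/
theorem eventually_add_smul (hc : IsDensity h c K) (a : Op) :
    ∀ᶠ ε : ℝ in 𝓝 0, IsDensity (h + ε • a) c K := by
  obtain ⟨U, hU, hhU, hr⟩ := hc.exists_rep
  have hs := upperHemicontinuousAt_iff.1
    ((upperHemicontinuous_spectrum ℝ Op).upperHemicontinuousAt h) U (hU.mem_nhdsSet.2 hhU)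
  have ht : Filter.Tendsto (fun ε : ℝ => h + ε • a) (𝓝 0) (𝓝 h) := by
    have : Continuous fun ε : ℝ => h + ε • a := by fun_prop
    simpa using this.tendsto 0
  filter_upwards [ht.eventually hs] with ε hε
  exact ⟨hc.moments, hc.continuous, U, hU, hU.mem_nhdsSet.1 hε, hr⟩

theorem rearr_eq (hc : IsDensity h c K) (hsa : IsSelfAdjoint h) (x : Op) :
    rearr h K ![x] = ∫ w, c w • (unitaryGroup h (w 0) * x * unitaryGroup h (w 1)) := by
  obtain ⟨U, hU, hhU, hr⟩ := hc.exists_rep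
  rw [NCTorus.rearr_eq hc.moments.integrable polyBdd_coords.1.measurable hr hsa hU hhU
    (exists_testExtension hc.mem_CSpec)]
  congr 1

theorem rearr_face (hc : IsDensity h c K) (hsa : IsSelfAdjoint h) (i : Fin 2) (ρ : Fin 2 → Op) :
    rearr h (face i K) ρ = ∫ w, c w • ∫ s in (0 : ℝ)..1,
      (I * (w i : ℂ)) • expWord h (faceDir i coords (w, s)) ρ := by
  obtain ⟨U, hU, hhU, hr⟩ := hc.exists_rep
  have hp := polyBdd_faceDir i polyBdd_coords
  rw [NCTorus.rearr_eq (hasMoments_face hc.moments polyBdd_coords i).integrable hp.1.measurable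
    (hr.face hc.moments hc.continuous polyBdd_coords hU i) hsa hU hhU
    (exists_testExtension (hc.face_mem_CSpec i))]
  exact integral_face hc.moments i (polyBdd_expWord hsa hp ρ)

theorem rearr_lastFace (hc : IsDensity h c K) (hsa : IsSelfAdjoint h) (ρ : Fin 2 → Op) :
    rearr h (lastFace K) ρ = ∫ w, c w • ∫ s in (0 : ℝ)..1,
      (I * (w 0 : ℂ)) • expWord h (fun l => faceDir 0 coords (w, s) (l + 1)) ρ := by
  obtain ⟨U, hU, hhU, hr⟩ := hc.exists_rep
  have hm := hc.lastFace_mem_CSpec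
  rw [lastFace] at hm ⊢
  have hp : PolyBdd fun z (l : Fin 3) => faceDir 0 coords z (l + 1) :=
    PolyBdd.pi fun l => (polyBdd_faceDir 0 polyBdd_coords).apply (l + 1)
  rw [NCTorus.rearr_eq (hasMoments_face hc.moments polyBdd_coords 0).integrable hp.1.measurable
    (hr.face hc.moments hc.continuous polyBdd_coords hU 0).cyc hsa hU hhU
    (exists_testExtension hm)]
  exact integral_face hc.moments 0 (polyBdd_expWord hsa hp ρ)

/-- The frequencies of this face are `(1-s)w₀`, `sw₀`, `w₁`, so the integral over `s` is the Duhamel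
integral of the first exponential. -/
theorem rearr_face_zero (hc : IsDensity h c K) (hsa : IsSelfAdjoint h) (x : Op) :
    rearr h (face 0 K) ![x, x] =
      ∫ w, c w • (groupDeriv h x (w 0) * x * unitaryGroup h (w 1)) := by
  rw [hc.rearr_face hsa]
  congr 1
  ext1 w
  rw [mul_assoc, groupDeriv_mul]
  congr 2

theorem rearr_face_one (hc : IsDensity h c K) (hsa : IsSelfAdjoint h) (x : Op) :
    rearr h (face 1 K) ![x, x] =
      ∫ w, c w • (unitaryGroup h (w 0) * x * groupDeriv h x (w 1)) := by
  rw [hc.rearr_face hsa]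
  congr 1
  ext1 w
  rw [mul_groupDeriv]
  congr 2

/-- Rotating the frequencies of the first face gives `sw₀`, `w₁`, `(1-s)w₀`: the pieces of the split
exponential move to the two ends of the word. -/
theorem rearr_lastFace_eq (hc : IsDensity h c K) (hsa : IsSelfAdjoint h) (x : Op) :
    rearr h (lastFace K) ![x, x] = ∫ w, c w • ∫ s in (0 : ℝ)..1, (I * (w 0 : ℂ)) •
      (unitaryGroup h (s * w 0) * (x * unitaryGroup h (w 1) * x) *
        unitaryGroup h ((1 - s) * w 0)) := by
  rw [hc.rearr_lastFace hsa]
  congr 1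

end IsDensity

end NCTorus

namespace NCTorus

open MeasureTheory
open scoped FourierTransform Topology

/-- Words in smooth elements and `e^{ith}` form tame families in both directions, and the density of
a test extension has all moments. -/
theorem rearr_mem_smoothTorus {θ : ℝ} {n : ℕ} {h : Op} (hh : h ∈ smoothTorus θ)
    (hsa : IsSelfAdjoint h) {f : (Fin (n + 1) → ℝ) → ℂ} (hf : f ∈ CSpec n h) {ρ : Fin n → Op}
    (hρ : ∀ i, ρ i ∈ smoothTorus θ) : rearr h f ρ ∈ smoothTorus θ := by
  obtain ⟨g, hg⟩ := exists_testExtension hf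
  obtain ⟨-, U, hU, hhU, hgU⟩ := id hg
  have hp : ∀ i, PolyBdd fun w : EuclideanSpace ℝ (Fin (n + 1)) => w i := fun i =>
    PolyBdd.of_clm (EuclideanSpace.proj (𝕜 := ℝ) i)
  rw [rearr_eq (hasMoments_hat g).integrable (PolyBdd.pi hp).1.measurable
    (IsTestExtension.isFourierRep hgU) hsa hU hhU ⟨g, hg⟩]
  exact integral_mem_smoothTorus (hasMoments_hat g) fun j k => Tame.expWord hh hsa hρ hp

/-! ### The gradient of the quadratic functional -/

section Gradient

variable {θ : ℝ} {j : Fin 2} {h a : Op} {b c : Plane → ℂ} {T K : (Fin 2 → ℝ) → ℂ}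

theorem IsDensity.quadFunctional_eq (hb : IsDensity h b T) (hsa : IsSelfAdjoint h) :
    quadFunctional θ j T h = ∫ w, b w * trace (word h (basicDeriv θ j h) w) := by
  have hu := fun i : Fin 2 => (polyBdd_unitaryGroup hsa).comp (polyBdd_apply i)
  rw [quadFunctional, hb.rearr_eq hsa,
    integral_smul_trace hb.moments (((hu 0).mul (PolyBdd.const _)).mul (hu 1))]
  rfl

theorem IsDensity.hasDerivAt_quadFunctional (hb : IsDensity h b T) (hh : h ∈ smoothTorus θ)
    (hsa : IsSelfAdjoint h) (ha : a ∈ smoothTorus θ) (hasa : IsSelfAdjoint a) :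
    HasDerivAt (fun ε : ℝ => quadFunctional θ j T (h + ε • a))
      (∫ w, b w * trace (wordDeriv h (basicDeriv θ j h) a (basicDeriv θ j a) w)) 0 := by
  refine (hasDerivAt_integral_word hb.moments hsa hasa (basicDeriv θ j h)
    (basicDeriv θ j a)).congr_of_eventuallyEq ?_
  filter_upwards [hb.eventually_add_smul a] with ε hε
  rw [hε.quadFunctional_eq (isSelfAdjoint_add_smul hsa hasa ε), basicDeriv_add_smul j hh ha]

theorem unitaryGroup_mem_commutant (hh : h ∈ smoothTorus θ) (t : ℝ) :
    unitaryGroup h t ∈ commutant θ :=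
  (isDer_unitaryGroup (isDer_basicDeriv 0 hh) t).left_mem

theorem groupDeriv_mem_commutant (hh : h ∈ smoothTorus θ) {x : Op} (hx : x ∈ commutant θ) (t : ℝ) :
    groupDeriv h x t ∈ commutant θ := by
  rw [groupDeriv_eq, intervalIntegral.integral_of_le zero_le_one]
  exact integral_mem_commutant fun s => Subalgebra.smul_mem _
    (mul_mem (mul_mem (unitaryGroup_mem_commutant hh _) hx) (unitaryGroup_mem_commutant hh _)) _

/-- The trace property symmetrizes the density. -/
theorem integral_trace_wordDeriv (hb : HasMoments volume b) (hh : h ∈ smoothTorus θ)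
    (hsa : IsSelfAdjoint h) {h' a' : Op} (hh' : h' ∈ commutant θ) (ha : a ∈ commutant θ)
    (ha' : a' ∈ commutant θ) :
    ∫ w, b w * trace (wordDeriv h h' a a' w) =
      ∫ w, -(b w + b (flip w)) * -trace (groupDeriv h a (w 0) * h' * unitaryGroup h (w 1) * h' +
        unitaryGroup h (w 0) * h' * unitaryGroup h (w 1) * a') := by
  have mu := fun t => unitaryGroup_mem_commutant hh t
  have md := fun t => groupDeriv_mem_commutant hh ha t
  set f : Plane → ℂ := fun w =>
    trace (groupDeriv h a (w 0) * h' * unitaryGroup h (w 1) * h' +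
        unitaryGroup h (w 0) * h' * unitaryGroup h (w 1) * a') with hf
  -- A cyclic rotation turns the terms with the second exponential or the first `h'` varied into the
  -- other two terms at exchanged Fourier variables.
  have e : ∀ w, trace (wordDeriv h h' a a' w) = f w + f (flip w) := fun w => by
    have e0 : flip w 0 = w 1 := flip_apply w 0
    have e1 : flip w 1 = w 0 := flip_apply w 1
    simp only [hf, e0, e1, wordDeriv, trace_add]
    rw [mul_assoc (unitaryGroup h (w 0) * h'), mul_assoc (unitaryGroup h (w 0) * a'),
      trace_mul_comm (mul_mem (mu _) hh') (mul_mem (md _) hh'),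
      trace_mul_comm (mul_mem (mu _) ha') (mul_mem (mu _) hh')]
    simp only [mul_assoc]
    ring
  have hp : PolyBdd f := by
    have u := fun i : Fin 2 => (polyBdd_unitaryGroup hsa).comp (polyBdd_apply i)
    have d := fun i : Fin 2 => (polyBdd_groupDeriv hsa a).comp (polyBdd_apply i)
    have k := fun x : Op => PolyBdd.const (Ω := Plane) x
    exact polyBdd_trace (((((d 0).mul (k h')).mul (u 1)).mul (k h')).add
      ((((u 0).mul (k h')).mul (u 1)).mul (k a')))
  have i1 : Integrable fun w => b w * f w := hb.integrable_smul hp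
  have i2 : Integrable fun w => b (flip w) * f w := hb.comp_flip.integrable_smul hp
  have i3 : Integrable fun w => b w * f (flip w) :=
    hb.integrable_smul (hp.comp (PolyBdd.of_clm (flip : Plane →L[ℝ] Plane)))
  have e2 : ∫ w, b (flip w) * f w = ∫ w, b w * f (flip w) := by
    rw [← integral_comp_flip]
    simp_rw [flip_flip]
  simp_rw [e, mul_add, neg_mul_neg, add_mul]
  rw [integral_add i1 i3, integral_add i1 i2, e2]

/-- Integration by parts in the second term of the first variation. -/
theorem trace_word_deriv {h' h'' a' : Op} (hd : IsDer θ j h h') (hd' : IsDer θ j h' h'')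
    (hda : IsDer θ j a a') (s t : ℝ) :
    -trace (unitaryGroup h s * h' * unitaryGroup h t * a') =
      trace (unitaryGroup h s * h'' * unitaryGroup h t * a) +
        trace (groupDeriv h h' s * h' * unitaryGroup h t * a) +
        trace (unitaryGroup h s * h' * groupDeriv h h' t * a) := by
  rw [← (((isDer_unitaryGroup hd s).mul hd').mul (isDer_unitaryGroup hd t)).trace_mul hda]
  simp only [add_mul, trace_add]
  ring

/-- The first variation in terms of a Fourier density. -/
theorem IsDensity.integral_eq (hc : IsDensity h c K) (hh : h ∈ smoothTorus θ)
    (hsa : IsSelfAdjoint h) (ha : a ∈ smoothTorus θ) :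
    ∫ w, c w * -trace (groupDeriv h a (w 0) * basicDeriv θ j h * unitaryGroup h (w 1) *
          basicDeriv θ j h +
        unitaryGroup h (w 0) * basicDeriv θ j h * unitaryGroup h (w 1) * basicDeriv θ j a) =
      trace ((rearr h K ![basicDeriv θ j (basicDeriv θ j h)] +
        (rearr h (face 0 K) ![basicDeriv θ j h, basicDeriv θ j h] +
          rearr h (face 1 K) ![basicDeriv θ j h, basicDeriv θ j h] -
          rearr h (lastFace K) ![basicDeriv θ j h, basicDeriv θ j h])) * a) := by
  set x := basicDeriv θ j h with hx
  have hd := isDer_basicDeriv j hh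
  have hd' := isDer_basicDeriv j (basicDeriv_mem j hh)
  have hda := isDer_basicDeriv j ha
  have u := fun i : Fin 2 => (polyBdd_unitaryGroup hsa).comp (polyBdd_apply i)
  have d := fun i : Fin 2 => (polyBdd_groupDeriv hsa x).comp (polyBdd_apply i)
  have k := fun y : Op => PolyBdd.const (Ω := Plane) y
  have hu := polyBdd_unitaryGroup hsa
  have p0 := ((u 0).mul (k (basicDeriv θ j x))).mul (u 1)
  have p1 := ((d 0).mul (k x)).mul (u 1)
  have p2 := ((u 0).mul (k x)).mul (d 1)
  have p3 : PolyBdd fun w : Plane => ∫ s in (0 : ℝ)..1, (I * (w 0 : ℂ)) •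
      (unitaryGroup h (s * w 0) * (x * unitaryGroup h (w 1) * x) *
        unitaryGroup h ((1 - s) * w 0)) := by
    have q := fun i : Fin 2 => (polyBdd_apply i).comp (polyBdd_fst (Ω := Plane))
    exact PolyBdd.intervalIntegral (E := fun z : Plane × ℝ => (I * (z.1 0 : ℂ)) •
      (unitaryGroup h (z.2 * z.1 0) * (x * unitaryGroup h (z.1 1) * x) *
        unitaryGroup h ((1 - z.2) * z.1 0)))
      (((PolyBdd.const I).mul (q 0).ofReal).smul
        (((hu.comp (polyBdd_snd.mul (q 0))).mul
          (((PolyBdd.const x).mul (hu.comp (q 1))).mul (PolyBdd.const x))).mul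
          (hu.comp (polyBdd_one_sub_snd.mul (q 0)))))
  have tr : ∀ {X : Plane → Op}, PolyBdd X → Integrable fun w => c w * trace (X w * a) :=
    fun hX => hc.moments.integrable_smul (polyBdd_trace (hX.mul (k a)))
  have i12 : Integrable fun w => c w * trace (groupDeriv h x (w 0) * x * unitaryGroup h (w 1) * a) +
      c w * trace (unitaryGroup h (w 0) * x * groupDeriv h x (w 1) * a) := (tr p1).add (tr p2)
  rw [hc.rearr_eq hsa, hc.rearr_face_zero hsa, hc.rearr_face_one hsa, hc.rearr_lastFace_eq hsa,
    add_mul, sub_mul, add_mul, sub_eq_add_neg, ← neg_one_smul ℂ (_ * a : Op)]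
  simp only [trace_add, trace_smul]
  rw [integral_smul_trace hc.moments p0, integral_smul_trace hc.moments p1,
    integral_smul_trace hc.moments p2, integral_smul_trace hc.moments p3, neg_one_mul,
    ← sub_eq_add_neg, ← integral_add (tr p1) (tr p2), ← integral_sub i12 (tr p3)]
  refine Eq.trans ?_ (integral_add (tr p0) (i12.sub (tr p3)))
  congr 1
  ext1 w
  -- The last-face term is rotated back into a trace with the derivative in the direction `a`; what
  -- remains is the integration by parts.
  rw [← trace_groupDeriv_mul hsa hh (mem_smoothTorus_iff.1 ha).1
    (mul_mem (mul_mem hd.right_mem (unitaryGroup_mem_commutant hh _)) hd.right_mem)]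
  have := trace_word_deriv hd hd' hda (w 0) (w 1)
  rw [← hx] at this ⊢
  rw [neg_add, this]
  simp only [mul_assoc]
  ring

end Gradient

/-! ### The functional relation -/

theorem face_zero_apply (K : (Fin 2 → ℝ) → ℂ) {x y z : ℝ} (hxy : x ≠ y) :
    face 0 K ![x, y, z] = (K ![y, z] - K ![x, z]) / (y - x) := by
  have e : ∀ t : ℝ, Function.update
      (fun l : Fin 2 => (![x, y, z] : Fin 3 → ℝ) ((0 : Fin 2).succ.succAbove l)) 0 t = ![t, z] := by
    intro t
    ext l
    fin_cases l <;> rfl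
  change dslope (fun t : ℝ => K (Function.update
    (fun l : Fin 2 => (![x, y, z] : Fin 3 → ℝ) ((0 : Fin 2).succ.succAbove l)) 0 t)) x y = _
  simp_rw [e]
  rw [dslope_of_ne _ hxy.symm, slope_def_module, ← Complex.coe_smul, smul_eq_mul,
    div_eq_inv_mul]
  push_cast
  rfl

theorem face_one_apply (K : (Fin 2 → ℝ) → ℂ) {x y z : ℝ} (hyz : y ≠ z) :
    face 1 K ![x, y, z] = (K ![x, z] - K ![x, y]) / (z - y) := by
  have e : ∀ t : ℝ, Function.update
      (fun l : Fin 2 => (![x, y, z] : Fin 3 → ℝ) ((1 : Fin 2).succ.succAbove l)) 1 t = ![x, t] := by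
    intro t
    ext l
    fin_cases l <;> rfl
  change dslope (fun t : ℝ => K (Function.update
    (fun l : Fin 2 => (![x, y, z] : Fin 3 → ℝ) ((1 : Fin 2).succ.succAbove l)) 1 t)) y z = _
  simp_rw [e]
  rw [dslope_of_ne _ hyz.symm, slope_def_module, ← Complex.coe_smul, smul_eq_mul,
    div_eq_inv_mul]
  push_cast
  rfl

theorem lastFace_apply (K : (Fin 2 → ℝ) → ℂ) {x y z : ℝ} (hxz : z ≠ x) :
    lastFace K ![x, y, z] = (K ![x, y] - K ![z, y]) / (x - z) := by
  rw [← face_zero_apply K hxz, lastFace, cyc]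
  congr 1
  ext l
  fin_cases l <;> rfl

theorem cyc_apply (T : (Fin 2 → ℝ) → ℂ) (x y : ℝ) : cyc T ![x, y] = T ![y, x] := by
  rw [cyc]
  congr 1
  ext l
  fin_cases l <;> rfl

end NCTorus

/-! ### Assembly of the gradient formula and the functional relation. -/

theorem mainTheorem3 (θ : ℝ) (j : Fin 2)
    (h : NCTorus.Op) (hh : h ∈ NCTorus.smoothTorus θ) (hsa : IsSelfAdjoint h)
    (T : (Fin 2 → ℝ) → ℂ) (hT : T ∈ NCTorus.CSpec 1 h)
    (K : (Fin 2 → ℝ) → ℂ) (hK : K = -(T + NCTorus.cyc T))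
    (H : (Fin 3 → ℝ) → ℂ)
    (hH : H = NCTorus.face 0 K + NCTorus.face 1 K - NCTorus.lastFace K) :
    K ∈ NCTorus.CSpec 1 h ∧ H ∈ NCTorus.CSpec 2 h ∧
    NCTorus.IsGradient θ (NCTorus.quadFunctional θ j T) h
      (NCTorus.rearr h K ![NCTorus.basicDeriv θ j (NCTorus.basicDeriv θ j h)] +
        NCTorus.rearr h H ![NCTorus.basicDeriv θ j h, NCTorus.basicDeriv θ j h]) ∧
    (∀ G : NCTorus.Op, NCTorus.IsGradient θ (NCTorus.quadFunctional θ j T) h G →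
      G = NCTorus.rearr h K ![NCTorus.basicDeriv θ j (NCTorus.basicDeriv θ j h)] +
        NCTorus.rearr h H ![NCTorus.basicDeriv θ j h, NCTorus.basicDeriv θ j h]) ∧
    (∀ (S : Set ℝ) (κ : ℝ → ℂ),
      (∀ x₀ ∈ S, ∀ x₁ ∈ S, K ![x₀, x₁] = κ (x₁ - x₀)) →
      ∀ x₀ ∈ S, ∀ x₁ ∈ S, ∀ x₂ ∈ S, ∀ u v : ℝ, u = x₁ - x₀ → v = x₂ - x₁ →
        u ≠ 0 → v ≠ 0 → u + v ≠ 0 →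
        -H ![x₀, x₁, x₂] =
          (κ v - κ u) / (u + v) + (κ (u + v) - κ v) / u - (κ (u + v) - κ u) / v) := by
  open NCTorus in
  obtain ⟨b, hb⟩ := exists_isDensity hT
  have hc := hb.symmetrize
  rw [← hK] at hc
  have hx := basicDeriv_mem j hh
  have hxx := basicDeriv_mem j hx
  have m01 := add_smul_mem_CSpec (hc.face_mem_CSpec 0) (hc.face_mem_CSpec 1) 1
  -- Written with scalars `1` and `-1` so that the linearity lemmas for `f + z • f'` apply.
  have hH' : H = face 0 K + (1 : ℂ) • face 1 K + (-1 : ℂ) • lastFace K := by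
    rw [hH, one_smul, neg_one_smul, sub_eq_add_neg]
  have hHm : H ∈ CSpec 2 h := hH' ▸ add_smul_mem_CSpec m01 hc.lastFace_mem_CSpec (-1)
  have hr : ∀ ρ, rearr h H ρ =
      rearr h (face 0 K) ρ + rearr h (face 1 K) ρ - rearr h (lastFace K) ρ := fun ρ => by
    rw [hH', rearr_add_smul hsa m01 hc.lastFace_mem_CSpec,
      rearr_add_smul hsa (hc.face_mem_CSpec 0) (hc.face_mem_CSpec 1), one_smul, neg_one_smul,
      sub_eq_add_neg]
  have hgrad : IsGradient θ (quadFunctional θ j T) h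
      (rearr h K ![basicDeriv θ j (basicDeriv θ j h)] +
        rearr h H ![basicDeriv θ j h, basicDeriv θ j h]) := by
    refine ⟨add_mem_smoothTorus
      (rearr_mem_smoothTorus hh hsa hc.mem_CSpec fun i => ?_)
      (rearr_mem_smoothTorus hh hsa hHm fun i => ?_), fun a ha hasa => ?_⟩
    · fin_cases i
      exact hxx
    · fin_cases i <;> exact hx
    · refine (hb.hasDerivAt_quadFunctional hh hsa ha hasa).congr_deriv ?_
      rw [integral_trace_wordDeriv hb.moments hh hsa (mem_smoothTorus_iff.1 hx).1
        (mem_smoothTorus_iff.1 ha).1 (mem_smoothTorus_iff.1 (basicDeriv_mem j ha)).1, hr]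
      exact hc.integral_eq hh hsa ha
  refine ⟨hc.mem_CSpec, hHm, hgrad, fun G hG => ?_, ?_⟩
  -- Two gradients have the same pairing with every self-adjoint `a`, by uniqueness of derivatives,
  -- and the trace separates points.
  · refine sub_eq_zero.1 (eq_zero_of_trace_mul_eq_zero (θ := θ)
      (sub_mem (mem_smoothTorus_iff.1 hG.1).1 (mem_smoothTorus_iff.1 hgrad.1).1)
      fun a ha hasa => ?_)
    have e := (hG.2 a ha hasa).unique (hgrad.2 a ha hasa)
    rw [sub_mul]
    exact (map_sub (coeffCLM 0) _ _).trans (sub_eq_zero.2 e)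
  · intro S κ hκ x₀ h₀ x₁ h₁ x₂ h₂ u v hu hv hu0 hv0 huv
    -- The last face involves `K(x₂, x₁)`; symmetry of `K` turns it into the value at `v` rather
    -- than `-v`.
    have hsymm : ∀ x y : ℝ, K ![x, y] = K ![y, x] := fun x y => by
      simp only [hK, Pi.neg_apply, Pi.add_apply, cyc_apply, add_comm]
    have n01 : x₀ ≠ x₁ := fun e => hu0 (by rw [hu, e, sub_self])
    have n12 : x₁ ≠ x₂ := fun e => hv0 (by rw [hv, e, sub_self])
    have n20 : x₂ ≠ x₀ := fun e => huv (by rw [hu, hv, e]; ring)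
    have k01 : K ![x₀, x₁] = κ u := by rw [hκ _ h₀ _ h₁, hu]
    have k12 : K ![x₁, x₂] = κ v := by rw [hκ _ h₁ _ h₂, hv]
    have k02 : K ![x₀, x₂] = κ (u + v) := by
      rw [hκ _ h₀ _ h₂, hu, hv]
      congr 1
      ring
    have d1 : (x₁ : ℂ) - x₀ = u := by rw [hu]; push_cast; rfl
    have d2 : (x₂ : ℂ) - x₁ = v := by rw [hv]; push_cast; rfl
    have d3 : (x₀ : ℂ) - x₂ = -(u + v) := by rw [← d1, ← d2]; ring
    rw [hH, Pi.sub_apply, Pi.add_apply, face_zero_apply K n01, face_one_apply K n12,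
      lastFace_apply K n20, hsymm x₂ x₁, k01, k12, k02, d1, d2, d3, div_neg]
    ring
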